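/- **Setting.** Let $\mathcal M$ be the set of probability vectors $(q,p_1,p_2)$ on the set of jumps $\{-1,1,2\}$, and $\Omega=\mathcal M^{\mathbb Z}$ (product $\sigma$-algebra). Write $(q(i),p_1(i),p_2(i))$ for the value of $\omega\in\Omega$ at $i\in\mathbb Z$. Let $P$ be a probability measure on $\Omega$ that is stationary and ergodic under the shift $(\theta\omega)_i=\omega_{i+1}$, and elliptic: for some $\varepsilon>0$, $P$-a.s., $q(i)>0$, $p_1(i)/q(i)\ge\varepsilon$ and $p_2(i)/q(i)\ge\varepsilon$ for all $i$. For $\omega\in\Omega$ and $k\in\mathbb Z$ let $P_\omega^k$ be the law of the Markov chain $(X_n)_{n\ge0}$ on $\mathbb Z$ with $X_0=k$ that jumps from $i$ to $i-1,i+1,i+2$ with probabilities $q(i),p_1(i),p_2(i)$. Put $P_\omega=P_\omega^0$, with expectation $E_\omega$, and let $\mathbb P=P\otimes P_\omega$ be the annealed law, $\mathbb P(F\times G)=\int_F P_\omega(G)\,P(d\omega)$. For $j=1,2$ let $P_\omega^{i-1}[(-\infty,i-1),i-1+j]$ be the $P_\omega^{i-1}$-probability that the walk reaches $[i,\infty)$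 for the first time at the point $i-1+j$, and set $$\gamma(i)=q(i)\,P_\omega^{i-1}[(-\infty,i-1),i+1],$$ $$\alpha(i)=q(i)\,P_\omega^{i-1}[(-\infty,i-1),i]\,\frac{p_1(i-1)}{p_1(i-1)+\gamma(i-1)},\qquad \beta(i)=q(i)\,P_\omega^{i-1}[(-\infty,i-1),i]\,\frac{\gamma(i-1)}{p_1(i-1)+\gamma(i-1)}.$$ Let $T_1=\inf\{n>0:X_n>X_0\}$. For $i\le0$ let $U(i)=[A(i),B(i),C(i)]$, where $A(i)$, $B(i)$, $C(i)$ are the numbers of steps from $i$ to $i-1$ before time $T_1$ after which the walk first returns to $[i,\infty)$ by a jump from $i-1$ to $i$, from $i-2$ to $i$, and from $i-1$ to $i+1$, respectively. Let $U(1)=[1,0,0]$, $[0,1,0]$ or $[0,0,1]$ according to whether the jump at time $T_1$ leads from $0$ to $1$, from $-1$ to $1$, or from $0$ to $2$. **Corollary 1.1.** Assume $X_n\to\infty$ $\mathbb P$-a.s. Then for $P$-a.e. $\omega$: (i) Under $P_\omega$, the sequence $U(1),U(0),U(-1),\dots$ is an inhomogeneous three-type branching process. That is, for $i\le 0$, conditionally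 on $U(1),\dots,U(i+1)$, the vector $U(i)$ is distributed as the sum of the offspring of independent particles, $U_k(i+1)$ of each type $k\in\{1,2,3\}$, where a particle of type $k$ has offspring law $P_\omega(U(i)=\cdot\mid U(i+1)=e_k)$; the conditioning events have positive probability. (ii) For every $i\le0$, $\alpha(i)+\beta(i)<1$, and the offspring mean matrix of the $(-i+1)$-th generation, whose $(k,l)$ entry is the (finite) mean number of type-$l$ children of a type-$k$ particle, $E_\omega[U_l(i)\mid U(i+1)=e_k]$, is $$N(i)=\begin{pmatrix}\frac{\alpha(i)}{1-\alpha(i)-\beta(i)}&\frac{\beta(i)}{1-\alpha(i)-\beta(i)}&0\\[2pt] \frac{\alpha(i)}{1-\alpha(i)-\beta(i)}&\frac{\beta(i)}{1-\alpha(i)-\beta(i)}&1\\[2pt] \frac{\alpha(i)}{1-\alpha(i)-\beta(i)}&\frac{\beta(i)}{1-\alpha(i)-\beta(i)}&0\end{pmatrix}.$$ (iii) As an identity in $[0,\infty]$, $$E_\omega(T_1)=1+\Big\langle(2,2,1),\ \frac1{1-\alpha(0)-\beta(0)}\big(p_1(0),\gamma(0),p_2(0)\big)\cdot\sum_{i\le0}N(0)N(-1)\cdots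 N(i)\Big\rangle.$$ -/

import Mathlib

open MeasureTheory ProbabilityTheory Filter
open scoped ENNReal Topology Matrix

noncomputable section

namespace RWRE

/-! ### Environments and the walk -/

/-- An environment: at every site `x` a probability vector `(q(x), p₁(x), p₂(x))` on the set of
jumps `{-1, 1, 2}`. The σ-algebra is the product of the Borel σ-algebras. -/
abbrev Env : Type := ℤ → stdSimplex ℝ (Fin 3)

/-- Probability of the jump `-1` at site `x`. -/
def q (ω : Env) (x : ℤ) : ℝ := (ω x : Fin 3 → ℝ) 0

/-- Probability of the jump `1` at site `x`. -/
def p₁ (ω : Env) (x : ℤ) : ℝ := (ω x : Fin 3 → ℝ) 1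

/-- Probability of the jump `2` at site `x`. -/
def p₂ (ω : Env) (x : ℤ) : ℝ := (ω x : Fin 3 → ℝ) 2

/-- The spatial shift `(θω)ₓ = ωₓ₊₁`. -/
def shift (ω : Env) : Env := fun x => ω (x + 1)

/-- Law of the position after one step from `x`. -/
def stepLaw (ω : Env) (x : ℤ) : Measure ℤ :=
  ENNReal.ofReal (q ω x) • Measure.dirac (x - 1)
    + ENNReal.ofReal (p₁ ω x) • Measure.dirac (x + 1)
    + ENNReal.ofReal (p₂ ω x) • Measure.dirac (x + 2)

/-- The transition kernel of the walk in the environment `ω`. -/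
def stepKernel (ω : Env) : Kernel ℤ ℤ := Kernel.ofFunOfCountable (stepLaw ω)

instance stepKernel_isMarkovKernel (ω : Env) : IsMarkovKernel (stepKernel ω) := by
  refine ⟨fun x => ⟨?_⟩⟩
  have h0 : 0 ≤ q ω x := (ω x).2.1 0
  have h1 : 0 ≤ p₁ ω x := (ω x).2.1 1
  have h2 : 0 ≤ p₂ ω x := (ω x).2.1 2
  have hs : q ω x + p₁ ω x + p₂ ω x = 1 := by
    have := (ω x).2.2
    rw [Fin.sum_univ_three] at this
    exact this
  change stepLaw ω x Set.univ = 1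
  simp only [stepLaw, Measure.add_apply, Measure.smul_apply, measure_univ, smul_eq_mul, mul_one]
  rw [← ENNReal.ofReal_add h0 h1, ← ENNReal.ofReal_add (add_nonneg h0 h1) h2, hs,
    ENNReal.ofReal_one]

/-- The step kernel as a function of the path up to time `n`: only the present position counts. -/
def pathKernel (ω : Env) (n : ℕ) : Kernel (Π _ : Finset.Iic n, ℤ) ℤ :=
  (stepKernel ω).comap (fun h => h ⟨n, Finset.mem_Iic.2 le_rfl⟩) (measurable_pi_apply _)

instance pathKernel_isMarkovKernel (ω : Env) (n : ℕ) : IsMarkovKernel (pathKernel ω n) := by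
  unfold pathKernel; infer_instance

/-- The quenched law `P_ω^k` on paths: the time-homogeneous Markov chain on `ℤ` started at `k`
with the transition probabilities given by `ω`. -/
def quenched (ω : Env) (k : ℤ) : Measure (ℕ → ℤ) :=
  Kernel.trajMeasure (X := fun _ => ℤ) (Measure.dirac k) (pathKernel ω)

instance quenched_isProbabilityMeasure (ω : Env) (k : ℤ) :
    IsProbabilityMeasure (quenched ω k) := by
  unfold quenched; infer_instance

lemma measurable_stepKernel_singleton (x y : ℤ) :
    Measurable fun ω : Env => stepKernel ω x {y} := by
  change Measurable fun ω : Env => stepLaw ω x {y}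
  simp only [stepLaw, Measure.add_apply, Measure.smul_apply, smul_eq_mul, q, p₁, p₂]
  have h : ∀ j : Fin 3, Measurable fun ω : Env => ENNReal.ofReal ((ω x : Fin 3 → ℝ) j) :=
    fun j => ENNReal.measurable_ofReal.comp
      ((measurable_pi_apply j).comp (measurable_subtype_coe.comp (measurable_pi_apply x)))
  exact (((h 0).mul_const _).add ((h 1).mul_const _)).add ((h 2).mul_const _)

lemma measurable_quenched_frestrictLe (k : ℤ) (n : ℕ) (y : Π _ : Finset.Iic n, ℤ) :
    Measurable fun ω : Env => ((quenched ω k).map (Preorder.frestrictLe n)) {y} := by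
  induction n with
  | zero =>
    have h : ∀ ω : Env, (quenched ω k).map (Preorder.frestrictLe 0)
        = (Measure.dirac k).map (MeasurableEquiv.piUnique
            (fun i : Finset.Iic 0 => (fun _ : ℕ => ℤ) i)).symm := by
      intro ω
      rw [quenched, Kernel.trajMeasure, Measure.map_comp _ _ (by fun_prop),
        Kernel.traj_map_frestrictLe, Kernel.partialTraj_self, Measure.id_comp]
    have h' : (fun ω : Env => ((quenched ω k).map (Preorder.frestrictLe 0)) {y}) = fun _ =>
        ((Measure.dirac k).map (MeasurableEquiv.piUnique
            (fun i : Finset.Iic 0 => (fun _ : ℕ => ℤ) i)).symm) {y} :=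
      funext fun ω => congrArg (fun m => m {y}) (h ω)
    rw [h']
    exact measurable_const
  | succ n ih =>
    have h : ∀ ω : Env, ((quenched ω k).map (Preorder.frestrictLe (n + 1))) {y}
        = ((quenched ω k).map (Preorder.frestrictLe n))
            {fun i => y ⟨i.1, Finset.mem_Iic.2 ((Finset.mem_Iic.1 i.2).trans n.le_succ)⟩}
          * stepKernel ω (y ⟨n, Finset.mem_Iic.2 n.le_succ⟩)
            {y ⟨n + 1, Finset.mem_Iic.2 le_rfl⟩} := by
      intro ω
      set y' : Π _ : Finset.Iic n, ℤ :=
        fun i => y ⟨i.1, Finset.mem_Iic.2 ((Finset.mem_Iic.1 i.2).trans n.le_succ)⟩ with hy'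
      have key := Kernel.map_frestrictLe_trajMeasure_compProd_eq_map_trajMeasure
        (X := fun _ => ℤ) (μ₀ := Measure.dirac k) (κ := pathKernel ω) (a := n)
      have key' := congrArg
        (fun m => m ({y'} ×ˢ {y ⟨n + 1, Finset.mem_Iic.2 le_rfl⟩})) key
      rw [Measure.compProd_apply_prod (measurableSet_singleton _) (measurableSet_singleton _),
        Measure.map_apply (by fun_prop)
          ((measurableSet_singleton _).prod (measurableSet_singleton _)),
        lintegral_singleton] at key'
      rw [Measure.map_apply (by fun_prop) (measurableSet_singleton _)]
      rw [mul_comm] at key'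
      refine Eq.trans ?_ key'.symm
      refine congrArg _ ?_
      ext x
      simp only [Set.mem_preimage, Set.mem_singleton_iff, Set.mem_prod, hy']
      constructor
      · intro h
        subst h
        exact ⟨rfl, rfl⟩
      · rintro ⟨h1, h2⟩
        funext i
        obtain ⟨i, hi⟩ := i
        rcases Nat.lt_or_ge n i with hlt | hle
        · obtain rfl : i = n + 1 := le_antisymm (Finset.mem_Iic.1 hi) hlt
          exact h2
        · exact congrFun h1 ⟨i, Finset.mem_Iic.2 hle⟩
    simp_rw [h]
    exact (ih _).mul (measurable_stepKernel_singleton _ _)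

/-- The quenched law depends measurably on the environment. -/
lemma measurable_quenched (k : ℤ) : Measurable fun ω : Env => quenched ω k := by
  refine Measurable.measure_of_isPiSystem_of_isProbabilityMeasure
    generateFrom_measurableCylinders.symm isPiSystem_measurableCylinders ?_
  intro t ht
  obtain ⟨n, S, hS, rfl⟩ : ∃ (n : ℕ) (S : Set (Π _ : Finset.Iic n, ℤ)), MeasurableSet S ∧
      t = Preorder.frestrictLe n ⁻¹' S := by
    obtain ⟨I, S, hS, rfl⟩ := (mem_measurableCylinders t).1 ht
    exact ⟨I.sup id, Finset.restrict₂ (π := fun _ : ℕ => ℤ) I.subset_Iic_sup_id ⁻¹' S,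
      (Finset.measurable_restrict₂ (X := fun _ : ℕ => ℤ) I.subset_Iic_sup_id) hS, rfl⟩
  have h : ∀ ω : Env, quenched ω k (Preorder.frestrictLe n ⁻¹' S)
      = ∑' y : S, ((quenched ω k).map (Preorder.frestrictLe n)) {(y : Π _ : Finset.Iic n, ℤ)} := by
    intro ω
    rw [← Measure.map_apply (by fun_prop) hS]
    conv_lhs => rw [← Set.biUnion_of_singleton S]
    rw [measure_biUnion S.to_countable]
    · intro a _ b _ hab
      exact Set.disjoint_singleton.2 hab
    · intro a _
      exact measurableSet_singleton a
  simp_rw [h]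
  exact Measurable.tsum fun y => measurable_quenched_frestrictLe k n _

/-- The quenched law of the walk started at `0`, as a kernel from environments to paths. -/
def quenchedKernel : Kernel Env (ℕ → ℤ) := ⟨fun ω => quenched ω 0, measurable_quenched 0⟩

instance quenchedKernel_isMarkovKernel : IsMarkovKernel quenchedKernel :=
  ⟨fun ω => quenched_isProbabilityMeasure ω 0⟩

/-- The annealed law `ℙ = P ⊗ P_ω`, i.e. `ℙ(F × G) = ∫_F P_ω(G) P(dω)`. -/
def annealed (P : Measure Env) : Measure (Env × (ℕ → ℤ)) := P ⊗ₘ quenchedKernel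

/-! ### Exit probabilities and the functions `α`, `β`, `γ` of the environment -/

/-- `P_ω^k[(-∞, k), k + j]`: the probability, starting from `k`, that the walk reaches
`[k + 1, ∞)` for the first time at the point `k + j`. -/
def exitProb (ω : Env) (k j : ℤ) : ℝ :=
  (quenched ω k).real {x | ∃ n : ℕ, (∀ m < n, x m ≤ k) ∧ k < x n ∧ x n = k + j}

/-- `γ(i)`. -/
def γ (ω : Env) (i : ℤ) : ℝ := q ω i * exitProb ω (i - 1) 2

/-- `α(i)`. -/
def α (ω : Env) (i : ℤ) : ℝ :=
  q ω i * exitProb ω (i - 1) 1 * (p₁ ω (i - 1) / (p₁ ω (i - 1) + γ ω (i - 1)))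

/-- `β(i)`. -/
def β (ω : Env) (i : ℤ) : ℝ :=
  q ω i * exitProb ω (i - 1) 1 * (γ ω (i - 1) / (p₁ ω (i - 1) + γ ω (i - 1)))

/-- The matrix `N(i)`. -/
def N (ω : Env) (i : ℤ) : Matrix (Fin 3) (Fin 3) ℝ :=
  !![α ω i / (1 - α ω i - β ω i), β ω i / (1 - α ω i - β ω i), 0;
     α ω i / (1 - α ω i - β ω i), β ω i / (1 - α ω i - β ω i), 1;
     α ω i / (1 - α ω i - β ω i), β ω i / (1 - α ω i - β ω i), 0]

/-- The ordered product `N(0) N(-1) ⋯ N(-n)`. -/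
def Nprod (ω : Env) : ℕ → Matrix (Fin 3) (Fin 3) ℝ
  | 0 => N ω 0
  | n + 1 => Nprod ω n * N ω (-((n : ℤ) + 1))

/-! ### The first ladder time and the branching structure of a path -/

/-- The first ladder time `T₁ = inf {n > 0 : Xₙ > X₀}`, equal to `∞` if there is no such `n`. -/
def T₁ (x : ℕ → ℤ) : ℕ∞ := ⨅ (n : ℕ) (_ : 0 < n ∧ x 0 < x n), (n : ℕ∞)

/-- The number of steps of the path `x` from `i` to `i - 1` before time `T₁` such that the next
return of the path to `[i, ∞)` is made by a jump from `s` to `t` (used with `s < i ≤ t`). A step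
is recorded by the time `k` at which it starts. -/
def crossings (x : ℕ → ℤ) (i s t : ℤ) : ℕ :=
  Set.ncard {k : ℕ | (k : ℕ∞) < T₁ x ∧ x k = i ∧ x (k + 1) = i - 1 ∧
    ∃ m : ℕ, k < m ∧ (∀ l, k < l → l ≤ m → x l < i) ∧ x m = s ∧ x (m + 1) = t}

open Classical in
/-- `1` if the jump made at time `T₁` leads from `s` to `t`, and `0` otherwise. -/
def finalJump (x : ℕ → ℤ) (s t : ℤ) : ℕ :=
  if ∃ m : ℕ, T₁ x = ((m + 1 : ℕ) : ℕ∞) ∧ x m = s ∧ x (m + 1) = t then 1 else 0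

/-- `U(i) = [A(i), B(i), C(i)]` for `i ≤ 0`: the numbers of steps from `i` to `i - 1` before `T₁`
with crossing-back from `i - 1` to `i`, from `i - 2` to `i`, and from `i - 1` to `i + 1`. For
`i = 1`, the immigrant: `[1,0,0]`, `[0,1,0]` or `[0,0,1]` according to whether the last jump before
`T₁` leads from `0` to `1`, from `-1` to `1`, or from `0` to `2`. (Not used for `i > 1`.) -/
def U (x : ℕ → ℤ) (i : ℤ) : Fin 3 → ℕ :=
  if i ≤ 0 then
    ![crossings x i (i - 1) i, crossings x i (i - 2) i, crossings x i (i - 1) (i + 1)]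
  else
    ![finalJump x 0 1, finalJump x (-1) 1, finalJump x 0 2]

/-! ### Multitype branching processes -/

/-- The law of the total offspring of a population with `z k` individuals of type `k`, each
individual of type `k` having offspring with law `κ k`, independently of all the others. -/
def totalOffspringLaw {d : ℕ} (κ : Fin d → Measure (Fin d → ℕ)) (z : Fin d → ℕ) :
    Measure (Fin d → ℕ) :=
  (Measure.pi fun p : (Σ k : Fin d, Fin (z k)) => κ p.1).map fun y => ∑ p, y p

/-- Under `μ`, the sequence `(Z n)` is an inhomogeneous `d`-type branching process in which an
individual of type `k` in generation `n` has offspring of law `κ n k` in generation `n + 1`: given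
generations `0, …, n`, generation `n + 1` has the law of the total offspring of generation `n`. -/
structure IsMultitypeBranching {S : Type*} [MeasurableSpace S] {d : ℕ} (μ : Measure S)
    (Z : ℕ → S → Fin d → ℕ) (κ : ℕ → Fin d → Measure (Fin d → ℕ)) : Prop where
  aemeasurable : ∀ n, AEMeasurable (Z n) μ
  isProbabilityMeasure : ∀ n k, IsProbabilityMeasure (κ n k)
  branching : ∀ (n : ℕ) (z : ℕ → Fin d → ℕ),
    μ {s | ∀ m ≤ n + 1, Z m s = z m} =
      μ {s | ∀ m ≤ n, Z m s = z m} * totalOffspringLaw (κ n) (z n) {z (n + 1)}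

/-- The quenched offspring law `P_ω(U(i) = · | U(i + 1) = e_k)` of a particle of type `k`. -/
def offspringLaw (ω : Env) (i : ℤ) (k : Fin 3) : Measure (Fin 3 → ℕ) :=
  ((quenched ω 0)[|{x | U x (i + 1) = Pi.single k 1}]).map fun x => U x i

/-- The offspring mean matrix: entry `(k, l)` is the expected number of children of type `l` of an
individual of type `k`. -/
def meanMatrix {d : ℕ} (κ : Fin d → Measure (Fin d → ℕ)) : Matrix (Fin d) (Fin d) ℝ :=
  Matrix.of fun k l => ∫ u, (u l : ℝ) ∂κ k

end RWRE

end

open RWRE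

namespace RWRE

/-! Pair every step from `i` to `i - 1` with the jump that brings the walk back to `[i, ∞)`. Then
`U(i)` merely counts the jumps `i-1 → i`, `i-2 → i` and `i-1 → i+1` made before the walk becomes
positive, and for `i = 1` the same counts describe the jump at time `T₁` (`IsWalkPath.U_eq`). Hence
`∏ s(i,t)^{U_t(i)}` is a product of step weights along the path, and its mean is a weighted exit
functional from `(-∞, 0]`. Such functionals are handled as minimal nonnegative solutions of a linear
equation (`exitSum_le`); this gives the strong Markov property by comparison.

Decomposing a path from `k` at its first step and its return to `[k, ∞)` gives a rational recursion
in the level `k`. If `j` is the lowest level with nontrivial marks, everything further down consists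
of exit probabilities, and `exitGen_lowest` shows that `s(j)` enters only through the common
denominator `1 - α s(j,0) - β s(j,1)` and through `s(j,2)` next to `s(j+1,1)`. So `s(j)` can be
erased if `s(j+1)` is multiplied by `offspringGen` (`exitGen_absorb`). This is the composition rule
for generating functions of a branching process. Generating functions determine laws on countable
spaces (`measure_ext_of_submonoid`), so the branching property follows.

The offspring law is `geomOffspring`: trials with outcomes of probabilities `α` and `β` until a
third outcome occurs, plus one child of type `2` exactly when the parent has type `1`, because a
jump `i-1 → i+1` is seen from both levels. All unit vectors have positive probability, so this is
the conditional law in the statement, and its means are the entries of `N`. For the last part, `T₁ =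
1 + ∑ ⟨(2,2,1), U(i)⟩` holds path by path through a telescoping sum, and the means of the
generations are matrix products. -/

lemma q_nonneg (ω : Env) (x : ℤ) : 0 ≤ q ω x := (ω x).2.1 0
lemma p₁_nonneg (ω : Env) (x : ℤ) : 0 ≤ p₁ ω x := (ω x).2.1 1
lemma p₂_nonneg (ω : Env) (x : ℤ) : 0 ≤ p₂ ω x := (ω x).2.1 2
lemma q_add_p₁_add_p₂ (ω : Env) (x : ℤ) : q ω x + p₁ ω x + p₂ ω x = 1 := by
  have := (ω x).2.2
  rwa [Fin.sum_univ_three] at this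

/-! ### The Markov property at time one -/

lemma measurableSet_cylinder_le (y : ℕ → ℤ) (n : ℕ) :
    MeasurableSet {x : ℕ → ℤ | ∀ i ≤ n, x i = y i} := by
  have : {x : ℕ → ℤ | ∀ i ≤ n, x i = y i} = ⋂ i ∈ Set.Iic n, (fun x => x i) ⁻¹' {y i} := by
    ext x; simp
  rw [this]
  exact MeasurableSet.biInter (Set.to_countable _)
    fun i _ => measurable_pi_apply i (measurableSet_singleton _)

/-- A law on integer sequences is determined by the probabilities of finite initial segments. -/
lemma measure_ext_of_cylinder {μ ν : Measure (ℕ → ℤ)} [IsProbabilityMeasure μ]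
    [IsProbabilityMeasure ν]
    (h : ∀ (y : ℕ → ℤ) (n : ℕ), μ {x | ∀ i ≤ n, x i = y i} = ν {x | ∀ i ≤ n, x i = y i}) :
    μ = ν := by
  refine ext_of_generate_finite _ generateFrom_measurableCylinders.symm
    isPiSystem_measurableCylinders ?_ (by simp)
  intro t ht
  obtain ⟨n, S, hS, rfl⟩ : ∃ (n : ℕ) (S : Set (Π _ : Finset.Iic n, ℤ)), MeasurableSet S ∧
      t = Preorder.frestrictLe n ⁻¹' S := by
    obtain ⟨I, S, hS, rfl⟩ := (mem_measurableCylinders t).1 ht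
    exact ⟨I.sup id, Finset.restrict₂ (π := fun _ : ℕ => ℤ) I.subset_Iic_sup_id ⁻¹' S,
      (Finset.measurable_restrict₂ (X := fun _ : ℕ => ℤ) I.subset_Iic_sup_id) hS, rfl⟩
  have hpre : ∀ y : Π _ : Finset.Iic n, ℤ,
      (Preorder.frestrictLe n ⁻¹' {y} : Set (ℕ → ℤ)) =
        {x | ∀ i ≤ n, x i = if hi : i ∈ Finset.Iic n then y ⟨i, hi⟩ else 0} := by
    intro y
    ext x
    simp only [Set.mem_preimage, Set.mem_singleton_iff, Set.mem_ofPred_eq]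
    constructor
    · rintro rfl i hi
      simp [hi]
    · intro hx
      funext i
      have := hx i (Finset.mem_Iic.1 i.2)
      simpa using this
  have hsum : ∀ ρ : Measure (ℕ → ℤ), ρ (Preorder.frestrictLe n ⁻¹' S)
      = ∑' y : S, ρ (Preorder.frestrictLe n ⁻¹' {(y : Π _ : Finset.Iic n, ℤ)}) := by
    intro ρ
    conv_lhs => rw [← Set.biUnion_of_singleton S, Set.preimage_iUnion₂]
    rw [measure_biUnion S.to_countable]
    · intro a _ b _ hab
      exact Disjoint.preimage _ (Set.disjoint_singleton.2 hab)
    · intro a _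
      exact (Preorder.measurable_frestrictLe n) (measurableSet_singleton a)
  rw [hsum, hsum]
  simp_rw [hpre, h]

lemma quenched_zero (ω : Env) (k : ℤ) (y : ℕ → ℤ) :
    quenched ω k {x | ∀ i ≤ 0, x i = y i} = if y 0 = k then 1 else 0 := by
  have h : (quenched ω k).map (Preorder.frestrictLe 0)
        = (Measure.dirac k).map (MeasurableEquiv.piUnique
            (fun i : Finset.Iic 0 => (fun _ : ℕ => ℤ) i)).symm := by
      rw [quenched, Kernel.trajMeasure, Measure.map_comp _ _ (by fun_prop),
        Kernel.traj_map_frestrictLe, Kernel.partialTraj_self, Measure.id_comp]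
  have h2 := congrArg (fun m => m {fun i => y i.1}) h
  rw [Measure.map_apply (by fun_prop) (measurableSet_singleton _),
    Measure.map_apply (by fun_prop) (measurableSet_singleton _), Measure.dirac_apply'] at h2
  · convert h2 using 1
    · congr 1
      ext x
      simp only [Set.mem_ofPred_eq, Set.mem_preimage, Set.mem_singleton_iff]
      constructor
      · intro hx
        funext i
        exact hx _ (Finset.mem_Iic.1 i.2)
      · intro hx i hi
        exact congrFun hx ⟨i, Finset.mem_Iic.2 hi⟩
    · classical
      rw [Set.indicator_apply]
      refine if_congr ?_ rfl rfl
      simp only [Set.mem_preimage, Set.mem_singleton_iff]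
      constructor
      · rintro rfl
        funext i
        obtain ⟨i, hi⟩ := i
        obtain rfl : i = 0 := by simpa using hi
        rfl
      · intro hx
        exact (congrFun hx ⟨0, by simp⟩).symm
  · exact (MeasurableEquiv.measurable _) (measurableSet_singleton _)

lemma quenched_succ (ω : Env) (k : ℤ) (y : ℕ → ℤ) (n : ℕ) :
    quenched ω k {x | ∀ i ≤ n + 1, x i = y i} =
      quenched ω k {x | ∀ i ≤ n, x i = y i} * stepKernel ω (y n) {y (n + 1)} := by
  set y' : Π _ : Finset.Iic n, ℤ := fun i => y i.1 with hy'
  have key := Kernel.map_frestrictLe_trajMeasure_compProd_eq_map_trajMeasure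
    (X := fun _ => ℤ) (μ₀ := Measure.dirac k) (κ := pathKernel ω) (a := n)
  have key' := congrArg (fun m => m ({y'} ×ˢ {y (n + 1)})) key
  rw [Measure.compProd_apply_prod (measurableSet_singleton _) (measurableSet_singleton _),
    Measure.map_apply (by fun_prop)
      ((measurableSet_singleton _).prod (measurableSet_singleton _)),
    lintegral_singleton, Measure.map_apply (by fun_prop) (measurableSet_singleton _),
    mul_comm] at key'
  have e1 : (Preorder.frestrictLe n ⁻¹' {y'} : Set (ℕ → ℤ)) = {x | ∀ i ≤ n, x i = y i} := by
    ext x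
    simp only [Set.mem_ofPred_eq, Set.mem_preimage, Set.mem_singleton_iff, hy']
    constructor
    · intro hx i hi
      exact congrFun hx ⟨i, Finset.mem_Iic.2 hi⟩
    · intro hx
      funext i
      exact hx _ (Finset.mem_Iic.1 i.2)
  rw [e1] at key'
  refine Eq.trans ?_ key'.symm
  refine congrArg _ ?_
  ext x
  simp only [Set.mem_preimage, Set.mem_singleton_iff, Set.mem_prod, Set.mem_ofPred_eq, hy']
  constructor
  · intro hx
    exact ⟨funext fun i => hx _ (Nat.le_succ_of_le (Finset.mem_Iic.1 i.2)), hx _ le_rfl⟩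
  · rintro ⟨h1, h2⟩ i hi
    rcases Nat.lt_or_ge n i with hlt | hle
    · obtain rfl : i = n + 1 := le_antisymm hi hlt
      exact h2
    · exact congrFun h1 ⟨i, Finset.mem_Iic.2 hle⟩

/-- The probability of a finite initial segment of the walk. -/
lemma quenched_cylinder (ω : Env) (k : ℤ) (y : ℕ → ℤ) (n : ℕ) :
    quenched ω k {x | ∀ i ≤ n, x i = y i} =
      (if y 0 = k then 1 else 0) * ∏ i ∈ Finset.range n, stepKernel ω (y i) {y (i + 1)} := by
  induction n with
  | zero => simpa using quenched_zero ω k y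
  | succ n ih => rw [quenched_succ, ih, Finset.prod_range_succ, mul_assoc]

/-- The path `x` preceded by the point `k`. -/
def consPath (k : ℤ) (x : ℕ → ℤ) : ℕ → ℤ := fun n => Nat.casesOn n k x

@[simp] lemma consPath_zero (k : ℤ) (x : ℕ → ℤ) : consPath k x 0 = k := rfl
@[simp] lemma consPath_succ (k : ℤ) (x : ℕ → ℤ) (n : ℕ) : consPath k x (n + 1) = x n := rfl

lemma measurable_consPath (k : ℤ) : Measurable (consPath k) := by
  refine measurable_pi_lambda _ fun n => ?_
  cases n with
  | zero => exact measurable_const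
  | succ n => exact measurable_pi_apply n

/-- Both sides are probability measures, so agreement on initial segments suffices; there the
product formula `quenched_cylinder` splits off the first transition. -/
lemma quenched_eq_first_step (ω : Env) (k : ℤ) :
    quenched ω k = ENNReal.ofReal (q ω k) • (quenched ω (k - 1)).map (consPath k)
      + ENNReal.ofReal (p₁ ω k) • (quenched ω (k + 1)).map (consPath k)
      + ENNReal.ofReal (p₂ ω k) • (quenched ω (k + 2)).map (consPath k) := by
  have hprob : ∀ j, IsProbabilityMeasure ((quenched ω j).map (consPath k)) := fun j =>
    Measure.isProbabilityMeasure_map (measurable_consPath k).aemeasurable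
  have : IsProbabilityMeasure (ENNReal.ofReal (q ω k) • (quenched ω (k - 1)).map (consPath k)
      + ENNReal.ofReal (p₁ ω k) • (quenched ω (k + 1)).map (consPath k)
      + ENNReal.ofReal (p₂ ω k) • (quenched ω (k + 2)).map (consPath k)) := by
    constructor
    simp only [Measure.add_apply, Measure.smul_apply, measure_univ, smul_eq_mul, mul_one]
    rw [← ENNReal.ofReal_add (q_nonneg ω k) (p₁_nonneg ω k),
      ← ENNReal.ofReal_add (add_nonneg (q_nonneg ω k) (p₁_nonneg ω k)) (p₂_nonneg ω k),
      q_add_p₁_add_p₂, ENNReal.ofReal_one]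
  refine measure_ext_of_cylinder fun y n => ?_
  simp only [Measure.add_apply, Measure.smul_apply, smul_eq_mul,
    Measure.map_apply (measurable_consPath k) (measurableSet_cylinder_le y n)]
  -- Prepending a point shifts the window by one: the condition at time `0` concerns `k` alone, and
  -- for `n = 0` no other condition remains.
  have hk : ∀ (n : ℕ) (j : ℤ), quenched ω j (consPath k ⁻¹' {x | ∀ i ≤ n, x i = y i})
      = if y 0 = k then (if n = 0 then 1 else quenched ω j {x | ∀ i ≤ n - 1, x i = y (i + 1)})
        else 0 := by
    intro n j
    split_ifs with h1 h2
    · subst h2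
      convert measure_univ (μ := quenched ω j)
      ext x
      simp [h1]
    · obtain ⟨m, rfl⟩ := Nat.exists_eq_succ_of_ne_zero h2
      congr 1
      ext x
      simp only [Set.mem_preimage, Set.mem_ofPred_eq, Nat.succ_eq_add_one, Nat.add_sub_cancel]
      constructor
      · intro hx i hi
        exact hx (i + 1) (by omega)
      · intro hx i hi
        cases i with
        | zero => exact h1.symm
        | succ i => exact hx i (by omega)
    · convert measure_empty (μ := quenched ω j)
      ext x
      simp only [Set.mem_preimage, Set.mem_ofPred_eq, Set.mem_empty_iff_false, iff_false]
      intro hx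
      exact h1 (hx 0 (Nat.zero_le _)).symm
  simp only [hk]
  split_ifs with h1 h2
  · subst h2
    rw [quenched_zero, if_pos h1, mul_one, mul_one, mul_one,
      ← ENNReal.ofReal_add (q_nonneg ω k) (p₁_nonneg ω k),
      ← ENNReal.ofReal_add (add_nonneg (q_nonneg ω k) (p₁_nonneg ω k)) (p₂_nonneg ω k),
      q_add_p₁_add_p₂, ENNReal.ofReal_one]
  · obtain ⟨m, rfl⟩ := Nat.exists_eq_succ_of_ne_zero h2
    simp only [Nat.succ_eq_add_one, Nat.add_sub_cancel]
    rw [quenched_cylinder, Finset.prod_range_succ', if_pos h1, one_mul]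
    simp only [quenched_cylinder ω _ (fun i => y (i + 1)) m, zero_add, ← mul_assoc, ← add_mul]
    rw [mul_comm]
    congr 1
    change stepLaw ω (y 0) {y 1} = _
    rw [h1]
    simp only [stepLaw, Measure.add_apply, Measure.smul_apply, smul_eq_mul,
      Measure.dirac_apply' _ (measurableSet_singleton _), Set.indicator_apply,
      Set.mem_singleton_iff, Pi.one_apply, eq_comm]
  · rw [quenched_cylinder, if_neg h1]
    simp

lemma lintegral_quenched (ω : Env) (k : ℤ) {F : (ℕ → ℤ) → ℝ≥0∞} (hF : Measurable F) :
    ∫⁻ x, F x ∂quenched ω k =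
      ENNReal.ofReal (q ω k) * ∫⁻ x, F (consPath k x) ∂quenched ω (k - 1)
      + ENNReal.ofReal (p₁ ω k) * ∫⁻ x, F (consPath k x) ∂quenched ω (k + 1)
      + ENNReal.ofReal (p₂ ω k) * ∫⁻ x, F (consPath k x) ∂quenched ω (k + 2) := by
  conv_lhs => rw [quenched_eq_first_step]
  simp only [lintegral_add_measure, lintegral_smul_measure, smul_eq_mul,
    lintegral_map hF (measurable_consPath k)]

lemma ae_quenched_zero (ω : Env) (k : ℤ) : ∀ᵐ x ∂quenched ω k, x 0 = k := by
  have h := quenched_zero ω k (fun _ => k)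
  rw [if_pos rfl] at h
  have := (prob_compl_eq_zero_iff (measurableSet_cylinder_le (fun _ => k) 0)).2 h
  filter_upwards [show ∀ᵐ x ∂quenched ω k, x ∈ {x : ℕ → ℤ | ∀ i ≤ 0, x i = k} from this]
    with x hx using hx 0 le_rfl

/-- Almost surely only the jumps `-1, 1, 2` occur. -/
lemma ae_quenched_step (ω : Env) (k : ℤ) : ∀ᵐ x ∂quenched ω k, ∀ n : ℕ,
    x (n + 1) = x n - 1 ∨ x (n + 1) = x n + 1 ∨ x (n + 1) = x n + 2 := by
  rw [ae_all_iff]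
  intro n
  -- Conditioning on the first step lowers the time index by one, which drives the induction on `n`.
  have aux : ∀ {k : ℤ} {p : (ℕ → ℤ) → Prop}, MeasurableSet {x | p x} →
      (∀ j, (j = k - 1 ∨ j = k + 1 ∨ j = k + 2) → ∀ᵐ x ∂quenched ω j, p (consPath k x)) →
      ∀ᵐ x ∂quenched ω k, p x := by
    intro k p hm hp
    rw [quenched_eq_first_step, ae_add_measure_iff, ae_add_measure_iff]
    refine ⟨⟨?_, ?_⟩, ?_⟩ <;> refine Measure.ae_smul_measure ?_ _ <;>
      rw [ae_map_iff (measurable_consPath k).aemeasurable hm]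
    exacts [hp _ (Or.inl rfl), hp _ (Or.inr (Or.inl rfl)), hp _ (Or.inr (Or.inr rfl))]
  have hmeas : ∀ n : ℕ, MeasurableSet {x : ℕ → ℤ |
      x (n + 1) = x n - 1 ∨ x (n + 1) = x n + 1 ∨ x (n + 1) = x n + 2} := by
    intro n
    have : Measurable fun x : ℕ → ℤ => (x (n + 1), x n) := by fun_prop
    exact this (MeasurableSet.of_discrete (s := {z : ℤ × ℤ |
      z.1 = z.2 - 1 ∨ z.1 = z.2 + 1 ∨ z.1 = z.2 + 2}))
  induction n generalizing k with
  | zero =>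
    refine aux (hmeas 0) fun j hj => ?_
    filter_upwards [ae_quenched_zero ω j] with x hx
    simpa [hx] using hj
  | succ n ih =>
    refine aux (hmeas _) fun j _ => ?_
    filter_upwards [ih j] with x hx
    simpa using hx

/-! ### Weighted exit functionals as minimal solutions -/

/-- The transition operator of the walk, the step from `y` to `y'` carrying the weight `g y y'`. -/
noncomputable def stepOp (ω : Env) (g : ℤ → ℤ → ℝ≥0∞) (f : ℤ → ℝ≥0∞) (y : ℤ) : ℝ≥0∞ :=
  ENNReal.ofReal (q ω y) * (g y (y - 1) * f (y - 1))
    + ENNReal.ofReal (p₁ ω y) * (g y (y + 1) * f (y + 1))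
    + ENNReal.ofReal (p₂ ω y) * (g y (y + 2) * f (y + 2))

lemma stepOp_mono (ω : Env) (g : ℤ → ℤ → ℝ≥0∞) {f f' : ℤ → ℝ≥0∞} (h : f ≤ f') :
    stepOp ω g f ≤ stepOp ω g f' := by
  intro y
  unfold stepOp
  gcongr <;> exact h _

lemma stepOp_iSup (ω : Env) (g : ℤ → ℤ → ℝ≥0∞) {f : ℕ → ℤ → ℝ≥0∞} (hf : Monotone f) (y : ℤ) :
    stepOp ω g (fun y => ⨆ n, f n y) y = ⨆ n, stepOp ω g (f n) y := by
  have hm : ∀ (c d : ℝ≥0∞) (z : ℤ), Monotone fun n => c * (d * f n z) := by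
    intro c d z m n hmn
    dsimp only
    gcongr
    exact hf hmn z
  unfold stepOp
  simp only [ENNReal.mul_iSup]
  rw [ENNReal.iSup_add_iSup_of_monotone (hm _ _ _) (hm _ _ _),
    ENNReal.iSup_add_iSup_of_monotone ((hm _ _ _).add (hm _ _ _)) (hm _ _ _)]

/-- The weighted exit functional from `(-∞, k]` with boundary values `h`, over fewer than `n`
steps. -/
noncomputable def exitIter (ω : Env) (k : ℤ) (g : ℤ → ℤ → ℝ≥0∞) (h : ℤ → ℝ≥0∞) :
    ℕ → ℤ → ℝ≥0∞
  | 0, _ => 0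
  | n + 1, y => if k < y then h y else stepOp ω g (exitIter ω k g h n) y

/-- The weighted exit functional from `(-∞, k]`: the sum over all exit paths from `y` of
probability times the product of the step weights times the value of `h` at the exit point. -/
noncomputable def exitSum (ω : Env) (k : ℤ) (g : ℤ → ℤ → ℝ≥0∞) (h : ℤ → ℝ≥0∞) (y : ℤ) : ℝ≥0∞ :=
  ⨆ n, exitIter ω k g h n y

lemma exitIter_le_succ (ω : Env) (k : ℤ) (g : ℤ → ℤ → ℝ≥0∞) (h : ℤ → ℝ≥0∞) (n : ℕ) :
    exitIter ω k g h n ≤ exitIter ω k g h (n + 1) := by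
  induction n with
  | zero => exact fun y => zero_le
  | succ n ih =>
    intro y
    rw [exitIter, exitIter]
    split_ifs
    · exact le_rfl
    · exact stepOp_mono ω g ih y

lemma exitIter_mono (ω : Env) (k : ℤ) (g : ℤ → ℤ → ℝ≥0∞) (h : ℤ → ℝ≥0∞) :
    Monotone (exitIter ω k g h) :=
  monotone_nat_of_le_succ (exitIter_le_succ ω k g h)

lemma exitSum_eq_iSup_succ (ω : Env) (k : ℤ) (g : ℤ → ℤ → ℝ≥0∞) (h : ℤ → ℝ≥0∞) (y : ℤ) :
    exitSum ω k g h y = ⨆ n, exitIter ω k g h (n + 1) y :=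
  (Monotone.iSup_nat_add (f := fun n => exitIter ω k g h n y)
    (fun _ _ hmn => exitIter_mono ω k g h hmn y) 1).symm

lemma exitSum_of_lt (ω : Env) {k y : ℤ} (g : ℤ → ℤ → ℝ≥0∞) (h : ℤ → ℝ≥0∞) (hy : k < y) :
    exitSum ω k g h y = h y := by
  rw [exitSum_eq_iSup_succ]
  simp [exitIter, hy]

lemma exitSum_of_le (ω : Env) {k y : ℤ} (g : ℤ → ℤ → ℝ≥0∞) (h : ℤ → ℝ≥0∞) (hy : y ≤ k) :
    exitSum ω k g h y = stepOp ω g (exitSum ω k g h) y := by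
  rw [exitSum_eq_iSup_succ]
  simp only [exitIter, not_lt.2 hy, if_false]
  exact (stepOp_iSup ω g (exitIter_mono ω k g h) y).symm

/-- The exit functional is the least superharmonic function with the given boundary values. -/
lemma exitSum_le (ω : Env) {k : ℤ} {g : ℤ → ℤ → ℝ≥0∞} {h f : ℤ → ℝ≥0∞}
    (h1 : ∀ y, k < y → h y ≤ f y) (h2 : ∀ y ≤ k, stepOp ω g f y ≤ f y) :
    exitSum ω k g h ≤ f := by
  intro y
  refine iSup_le fun n => ?_
  induction n generalizing y with
  | zero => exact zero_le
  | succ n ih =>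
    rw [exitIter]
    split_ifs with hy
    · exact h1 y hy
    · exact (stepOp_mono ω g (fun z => ih z) y).trans (h2 y (not_lt.1 hy))

/-- The strong Markov property at the exit from a smaller half line. -/
lemma exitSum_exitSum (ω : Env) {k k' : ℤ} (hk : k' ≤ k) (g : ℤ → ℤ → ℝ≥0∞) (h : ℤ → ℝ≥0∞) :
    exitSum ω k' g (exitSum ω k g h) = exitSum ω k g h := by
  have hle : exitSum ω k' g (exitSum ω k g h) ≤ exitSum ω k g h :=
    exitSum_le ω (fun y _ => le_rfl) fun y hy => (exitSum_of_le ω g h (hy.trans hk)).ge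
  -- For the reverse inequality the iterated functional is tested as a supersolution on the larger
  -- half line. For `k' < y ≤ k` it agrees with the direct one at `y`, and `hle` bounds its image
  -- under the step operator.
  refine le_antisymm hle (exitSum_le ω (fun y hy => ?_) fun y hy => ?_)
  · rw [exitSum_of_lt ω g _ (hk.trans_lt hy), exitSum_of_lt ω g _ hy]
  · by_cases hy' : y ≤ k'
    · exact (exitSum_of_le ω g _ hy').ge
    · rw [exitSum_of_lt ω g _ (not_le.1 hy'), exitSum_of_le ω g h hy]
      exact stepOp_mono ω g hle y

lemma exitSum_congr (ω : Env) {k : ℤ} {g g' : ℤ → ℤ → ℝ≥0∞} (h : ℤ → ℝ≥0∞)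
    (hg : ∀ y ≤ k, g y = g' y) : exitSum ω k g h = exitSum ω k g' h := by
  have : ∀ n, exitIter ω k g h n = exitIter ω k g' h n := by
    intro n
    induction n with
    | zero => rfl
    | succ n ih =>
      funext y
      rw [exitIter, exitIter, ih]
      split_ifs with hy
      · rfl
      · rw [stepOp, stepOp, hg y (not_lt.1 hy)]
  funext y
  simp only [exitSum, this]

lemma sum_ofReal_eq_one (ω : Env) (y : ℤ) : ENNReal.ofReal (q ω y) + ENNReal.ofReal (p₁ ω y)
    + ENNReal.ofReal (p₂ ω y) = 1 := by
  rw [← ENNReal.ofReal_add (q_nonneg ω y) (p₁_nonneg ω y),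
    ← ENNReal.ofReal_add (add_nonneg (q_nonneg ω y) (p₁_nonneg ω y)) (p₂_nonneg ω y),
    q_add_p₁_add_p₂, ENNReal.ofReal_one]

lemma exitSum_le_one (ω : Env) {k : ℤ} {g : ℤ → ℤ → ℝ≥0∞} {h : ℤ → ℝ≥0∞}
    (hg : ∀ y y', g y y' ≤ 1) (hh : ∀ y, h y ≤ 1) (y : ℤ) : exitSum ω k g h y ≤ 1 := by
  refine exitSum_le ω (f := fun _ => 1) (fun y _ => hh y) (fun y _ => ?_) y
  refine le_trans ?_ (sum_ofReal_eq_one ω y).le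
  unfold stepOp
  gcongr <;> exact mul_le_of_le_one_right' (by simpa using hg y _)

/-- The exit functional restricted to exits at the point `k + j`. -/
noncomputable def exitAt (ω : Env) (g : ℤ → ℤ → ℝ≥0∞) (k j : ℤ) : ℝ≥0∞ :=
  exitSum ω k g (Pi.single (k + j) 1) k

/-- Boundary values enter linearly, and a walk with jumps at most `2` can leave `(-∞, k]` only at `k
+ 1` or `k + 2`. -/
lemma exitSum_eq_sum (ω : Env) {k y : ℤ} (g : ℤ → ℤ → ℝ≥0∞) (h : ℤ → ℝ≥0∞) (hy : y ≤ k) :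
    exitSum ω k g h y = exitSum ω k g (Pi.single (k + 1) 1) y * h (k + 1)
      + exitSum ω k g (Pi.single (k + 2) 1) y * h (k + 2) := by
  -- The range is `y ≤ k + 2` because one step from `y ≤ k` may reach `k + 2`.
  have hn : ∀ n, ∀ y ≤ k + 2, exitIter ω k g h n y =
      exitIter ω k g (Pi.single (k + 1) 1) n y * h (k + 1)
      + exitIter ω k g (Pi.single (k + 2) 1) n y * h (k + 2) := by
    intro n
    induction n with
    | zero => intro y _; simp [exitIter]
    | succ n ih =>
      intro y hy
      rw [exitIter, exitIter, exitIter]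
      split_ifs with hky
      · have : y = k + 1 ∨ y = k + 2 := by omega
        rcases this with rfl | rfl <;> simp
      · unfold stepOp
        rw [ih (y - 1) (by omega), ih (y + 1) (by omega), ih (y + 2) (by omega)]
        ring
  have hm : ∀ t, Monotone fun n => exitIter ω k g (Pi.single t 1) n y * h t := by
    intro t m n hmn
    dsimp only
    gcongr
    exact exitIter_mono ω k g _ hmn y
  simp only [exitSum, hn _ y (by omega : y ≤ k + 2), ENNReal.iSup_mul]
  rw [ENNReal.iSup_add_iSup_of_monotone (hm _) (hm _)]

lemma exitSum_self (ω : Env) (k : ℤ) (g : ℤ → ℤ → ℝ≥0∞) (h : ℤ → ℝ≥0∞) :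
    exitSum ω k g h k = exitAt ω g k 1 * h (k + 1) + exitAt ω g k 2 * h (k + 2) :=
  exitSum_eq_sum ω g h le_rfl

/-- Starting at `k - 1`, the walk first leaves `(-∞, k - 1]`: either at `k`, where it starts afresh,
or at `k + 1`, where it is already outside `(-∞, k]`. -/
lemma exitSum_pred (ω : Env) (k : ℤ) (g : ℤ → ℤ → ℝ≥0∞) (h : ℤ → ℝ≥0∞) :
    exitSum ω k g h (k - 1) =
      exitAt ω g (k - 1) 1 * exitSum ω k g h k + exitAt ω g (k - 1) 2 * h (k + 1) := by
  conv_lhs => rw [← exitSum_exitSum ω (sub_one_lt k).le g h, exitSum_self]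
  rw [show k - 1 + 1 = k by ring, show k - 1 + 2 = k + 1 by ring,
    exitSum_of_lt ω g h (lt_add_one k)]

/-- Decomposition at the first step and at the return to the starting level: exit at `k + 1`. -/
lemma exitAt_one (ω : Env) (k : ℤ) (g : ℤ → ℤ → ℝ≥0∞) :
    exitAt ω g k 1 = ENNReal.ofReal (q ω k) * g k (k - 1) *
        (exitAt ω g (k - 1) 1 * exitAt ω g k 1 + exitAt ω g (k - 1) 2)
      + ENNReal.ofReal (p₁ ω k) * g k (k + 1) := by
  conv_lhs => rw [exitAt, exitSum_of_le ω g _ le_rfl, stepOp, exitSum_pred,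
    exitSum_of_lt ω g _ (lt_add_one k), exitSum_of_lt ω g _ (by omega : k < k + 2)]
  simp [exitAt, mul_assoc]

/-- Decomposition at the first step and at the return to the starting level: exit at `k + 2`. -/
lemma exitAt_two (ω : Env) (k : ℤ) (g : ℤ → ℤ → ℝ≥0∞) :
    exitAt ω g k 2 = ENNReal.ofReal (q ω k) * g k (k - 1) *
        (exitAt ω g (k - 1) 1 * exitAt ω g k 2)
      + ENNReal.ofReal (p₂ ω k) * g k (k + 2) := by
  conv_lhs => rw [exitAt, exitSum_of_le ω g _ le_rfl, stepOp, exitSum_pred,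
    exitSum_of_lt ω g _ (lt_add_one k), exitSum_of_lt ω g _ (by omega : k < k + 2)]
  simp [exitAt, mul_assoc]

lemma exitAt_le_one (ω : Env) {g : ℤ → ℤ → ℝ≥0∞} (hg : ∀ y y', g y y' ≤ 1) (k j : ℤ) :
    exitAt ω g k j ≤ 1 :=
  exitSum_le_one ω hg (fun y => by rw [Pi.single_apply]; split_ifs <;> simp) k

lemma exitAt_congr (ω : Env) {k : ℤ} (j : ℤ) {g g' : ℤ → ℤ → ℝ≥0∞}
    (hg : ∀ y ≤ k, g y = g' y) : exitAt ω g k j = exitAt ω g' k j := by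
  rw [exitAt, exitAt, exitSum_congr ω _ hg]

/-! ### Exit functionals as expectations -/

/-- The weight of a path stopped on leaving `(-∞, k]`, if this happens in fewer than `n` steps. -/
noncomputable def pathWeight (k : ℤ) (g : ℤ → ℤ → ℝ≥0∞) (h : ℤ → ℝ≥0∞) :
    ℕ → (ℕ → ℤ) → ℝ≥0∞
  | 0, _ => 0
  | n + 1, x => if k < x 0 then h (x 0) else g (x 0) (x 1) * pathWeight k g h n fun m => x (m + 1)

lemma measurable_pathWeight (k : ℤ) (g : ℤ → ℤ → ℝ≥0∞) (h : ℤ → ℝ≥0∞) (n : ℕ) :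
    Measurable (pathWeight k g h n) := by
  induction n with
  | zero => exact measurable_const
  | succ n ih =>
    refine Measurable.ite (measurable_pi_apply 0 (MeasurableSet.of_discrete (s := Set.Ioi k)))
      ((measurable_of_countable h).comp (measurable_pi_apply 0)) (Measurable.mul ?_ ?_)
    · exact (measurable_of_countable (fun z : ℤ × ℤ => g z.1 z.2)).comp
        (by fun_prop : Measurable fun x : ℕ → ℤ => (x 0, x 1))
    · exact ih.comp (measurable_pi_lambda _ fun m => measurable_pi_apply (m + 1))

lemma lintegral_pathWeight (ω : Env) (k : ℤ) (g : ℤ → ℤ → ℝ≥0∞) (h : ℤ → ℝ≥0∞) (n : ℕ) (y : ℤ) :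
    ∫⁻ x, pathWeight k g h n x ∂quenched ω y = exitIter ω k g h n y := by
  induction n generalizing y with
  | zero => simp [pathWeight, exitIter]
  | succ n ih =>
    rw [lintegral_quenched ω y (measurable_pathWeight k g h (n + 1)), exitIter]
    split_ifs with hy
    · simp only [pathWeight, consPath_zero, hy, if_true, lintegral_const, measure_univ, mul_one]
      rw [← add_mul, ← add_mul, sum_ofReal_eq_one, one_mul]
    · have key : ∀ z, ∫⁻ x, pathWeight k g h (n + 1) (consPath y x) ∂quenched ω z
          = g y z * exitIter ω k g h n z := by
        intro z
        rw [← ih z, ← lintegral_const_mul _ (measurable_pathWeight k g h n)]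
        refine lintegral_congr_ae ?_
        filter_upwards [ae_quenched_zero ω z] with x hx
        simp only [pathWeight, consPath_zero, hy, if_false, consPath_succ, hx]
      rw [key, key, key, stepOp]

/-- On a path with exit time `T` the truncated weight is `0` up to `n = T` and takes its final value
from `n = T + 1` on. -/
lemma pathWeight_eq_ite {k : ℤ} (g : ℤ → ℤ → ℝ≥0∞) (h : ℤ → ℝ≥0∞) {x : ℕ → ℤ} {T : ℕ}
    (h1 : ∀ m < T, x m ≤ k) (h2 : k < x T) (n : ℕ) :
    pathWeight k g h n x =
      if T < n then (∏ m ∈ Finset.range T, g (x m) (x (m + 1))) * h (x T) else 0 := by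
  induction n generalizing T x with
  | zero => simp [pathWeight]
  | succ n ih =>
    rw [pathWeight]
    cases T with
    | zero => simp [h2]
    | succ T =>
      rw [if_neg (not_lt.2 (h1 0 (Nat.succ_pos _))),
        ih (x := fun m => x (m + 1)) (T := T) (fun m hm => h1 (m + 1) (by omega)) h2,
        Finset.prod_range_succ']
      simp only [add_lt_add_iff_right, zero_add]
      split_ifs
      · ring
      · simp

lemma pathWeight_eq_zero {k : ℤ} (g : ℤ → ℤ → ℝ≥0∞) (h : ℤ → ℝ≥0∞) {x : ℕ → ℤ}
    (h1 : ∀ m, x m ≤ k) (n : ℕ) : pathWeight k g h n x = 0 := by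
  induction n generalizing x with
  | zero => rfl
  | succ n ih =>
    rw [pathWeight, if_neg (not_lt.2 (h1 0)), ih fun m => h1 (m + 1), mul_zero]

lemma iSup_pathWeight {k : ℤ} (g : ℤ → ℤ → ℝ≥0∞) (h : ℤ → ℝ≥0∞) {x : ℕ → ℤ} {T : ℕ}
    (h1 : ∀ m < T, x m ≤ k) (h2 : k < x T) :
    ⨆ n, pathWeight k g h n x = (∏ m ∈ Finset.range T, g (x m) (x (m + 1))) * h (x T) := by
  simp only [pathWeight_eq_ite g h h1 h2]
  refine le_antisymm (iSup_le fun n => ?_) (le_iSup_of_le (T + 1) ?_)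
  · split_ifs <;> simp
  · simp

lemma pathWeight_mono (k : ℤ) (g : ℤ → ℤ → ℝ≥0∞) (h : ℤ → ℝ≥0∞) (x : ℕ → ℤ) :
    Monotone fun n => pathWeight k g h n x := by
  by_cases hx : ∃ n, k < x n
  · intro m n hmn
    dsimp only
    rw [pathWeight_eq_ite g h (fun m hm => not_lt.1 (Nat.find_min hx hm)) (Nat.find_spec hx),
      pathWeight_eq_ite g h (fun m hm => not_lt.1 (Nat.find_min hx hm)) (Nat.find_spec hx)]
    split_ifs <;> first | omega | simp
  · push Not at hx
    intro m n _
    simp [pathWeight_eq_zero g h hx]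

lemma lintegral_iSup_pathWeight (ω : Env) (k : ℤ) (g : ℤ → ℤ → ℝ≥0∞) (h : ℤ → ℝ≥0∞) (y : ℤ) :
    ∫⁻ x, ⨆ n, pathWeight k g h n x ∂quenched ω y = exitSum ω k g h y := by
  rw [lintegral_iSup (measurable_pathWeight k g h) fun m n hmn x => pathWeight_mono k g h x hmn]
  simp only [lintegral_pathWeight, exitSum]

/-- With unit step weights and a point mass as boundary value, the path weight is the indicator of
the exit event. -/
lemma exitProb_eq (ω : Env) (k j : ℤ) : exitProb ω k j = (exitAt ω 1 k j).toReal := by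
  have hx : ∀ x : ℕ → ℤ, ⨆ n, pathWeight k 1 (Pi.single (k + j) 1) n x =
      {x : ℕ → ℤ | ∃ n : ℕ, (∀ m < n, x m ≤ k) ∧ k < x n ∧ x n = k + j}.indicator 1 x := by
    intro x
    classical
    rw [Set.indicator_apply]
    by_cases hx : ∃ n, k < x n
    · have h1 : ∀ m < Nat.find hx, x m ≤ k := fun m hm => not_lt.1 (Nat.find_min hx hm)
      have h2 := Nat.find_spec hx
      rw [iSup_pathWeight _ _ h1 h2, Pi.single_apply]
      simp only [Pi.one_apply, Finset.prod_const_one, one_mul]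
      refine if_congr ⟨fun h => ⟨_, h1, h2, h⟩, ?_⟩ rfl rfl
      rintro ⟨n, hn1, hn2, hn3⟩
      rwa [(Nat.find_eq_iff hx).2 ⟨hn2, fun m hm => not_lt.2 (hn1 m hm)⟩]
    · rw [if_neg fun h => hx ⟨h.choose, h.choose_spec.2.1⟩]
      push Not at hx
      simp [pathWeight_eq_zero _ _ hx]
  have hm : MeasurableSet
      {x : ℕ → ℤ | ∃ n : ℕ, (∀ m < n, x m ≤ k) ∧ k < x n ∧ x n = k + j} := by
    -- The exit event is measurable because its indicator is a supremum of measurable path weights.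
    have : {x : ℕ → ℤ | ∃ n : ℕ, (∀ m < n, x m ≤ k) ∧ k < x n ∧ x n = k + j} =
        (fun x => ⨆ n, pathWeight k 1 (Pi.single (k + j) 1) n x) ⁻¹' {1} := by
      ext x
      rw [Set.mem_preimage, hx, Set.mem_singleton_iff]
      by_cases h : x ∈ {x : ℕ → ℤ | ∃ n : ℕ, (∀ m < n, x m ≤ k) ∧ k < x n ∧ x n = k + j} <;>
        simp only [h, Set.indicator_of_mem, Set.indicator_of_notMem, not_false_eq_true] <;> simp
    rw [this]
    exact Measurable.iSup (measurable_pathWeight _ _ _) (measurableSet_singleton _)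
  rw [exitProb, Measure.real, exitAt, ← lintegral_iSup_pathWeight]
  simp only [hx]
  rw [lintegral_indicator_one hm]

/-! ### The branching structure as a count of upward jumps -/

/-- The first time at which the path is positive. -/
noncomputable def firstPos (x : ℕ → ℤ) : ℕ := sInf {n | 0 < x n}

/-- The number of jumps from `s` to `t` up to the first positive time. -/
noncomputable def jumpCount (x : ℕ → ℤ) (s t : ℤ) : ℕ :=
  ∑ m ∈ Finset.range (firstPos x), if x m = s ∧ x (m + 1) = t then 1 else 0

/-- The starting points of the upward jumps counted by the three components of `U(i)`. -/
def jumpSrc (i : ℤ) : Fin 3 → ℤ := ![i - 1, i - 2, i - 1]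

/-- The end points of the upward jumps counted by the three components of `U(i)`. -/
def jumpDst (i : ℤ) : Fin 3 → ℤ := ![i, i, i + 1]

/-- The numbers of jumps from `i - 1` to `i`, from `i - 2` to `i` and from `i - 1` to `i + 1` up to
the first positive time. -/
noncomputable def jumpVec (x : ℕ → ℤ) (i : ℤ) : Fin 3 → ℕ :=
  fun t => jumpCount x (jumpSrc i t) (jumpDst i t)

/-- `1` if the jump from `y` to `y'` is counted by the component `t` of `U(i)`. -/
def jumpMark (y y' i : ℤ) (t : Fin 3) : ℕ := if y = jumpSrc i t ∧ y' = jumpDst i t then 1 else 0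

lemma jumpMark_zero (y y' i : ℤ) :
    jumpMark y y' i 0 = if y = i - 1 ∧ y' = i then 1 else 0 := rfl
lemma jumpMark_one (y y' i : ℤ) :
    jumpMark y y' i 1 = if y = i - 2 ∧ y' = i then 1 else 0 := rfl
lemma jumpMark_two (y y' i : ℤ) :
    jumpMark y y' i 2 = if y = i - 1 ∧ y' = i + 1 then 1 else 0 := rfl

lemma jumpVec_eq (x : ℕ → ℤ) (i : ℤ) (t : Fin 3) :
    jumpVec x i t = ∑ m ∈ Finset.range (firstPos x), jumpMark (x m) (x (m + 1)) i t := rfl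

/-- A path of the walk from `0` that becomes positive. -/
structure IsWalkPath (x : ℕ → ℤ) : Prop where
  zero : x 0 = 0
  step : ∀ n, x (n + 1) = x n - 1 ∨ x (n + 1) = x n + 1 ∨ x (n + 1) = x n + 2
  exit : ∃ n, 0 < x n

namespace IsWalkPath

variable {x : ℕ → ℤ}

lemma pos_firstPos (hx : IsWalkPath x) : 0 < x (firstPos x) := Nat.sInf_mem hx.exit

lemma nonpos_of_lt (_hx : IsWalkPath x) {m : ℕ} (hm : m < firstPos x) : x m ≤ 0 :=
  not_lt.1 (Nat.notMem_of_lt_sInf hm)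

lemma T₁_eq (hx : IsWalkPath x) : T₁ x = firstPos x := by
  have h0 : 0 < firstPos x := by
    rw [Nat.pos_iff_ne_zero]
    intro h
    have := hx.pos_firstPos
    rw [h, hx.zero] at this
    exact lt_irrefl _ this
  refine le_antisymm (iInf₂_le _ ⟨h0, by rw [hx.zero]; exact hx.pos_firstPos⟩) ?_
  refine le_iInf₂ fun n hn => ?_
  rw [Nat.cast_le]
  exact Nat.sInf_le (by rw [hx.zero] at hn; exact hn.2)

lemma jumpCount_eq_ncard (x : ℕ → ℤ) (s t : ℤ) :
    jumpCount x s t = Set.ncard {m | m < firstPos x ∧ x m = s ∧ x (m + 1) = t} := by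
  rw [jumpCount, ← Finset.card_filter, ← Set.ncard_coe_finset]
  congr 1
  ext m
  simp

/-- A bijection between downward steps from `i` and upward jumps over or onto `i`: a step is sent to
the jump ending the excursion below `i` that it begins. -/
lemma crossings_eq (hx : IsWalkPath x) {i s t : ℤ} (hi : i ≤ 0) (hs : s < i) (ht : i ≤ t) :
    crossings x i s t = jumpCount x s t := by
  rw [jumpCount_eq_ncard, crossings, hx.T₁_eq]
  -- An excursion has one return jump: of two candidates, the earlier one lands at `t ≥ i` while the
  -- other still claims the path to be below `i`.
  have huniq : ∀ {k m m' : ℕ}, k < m → k < m' → (∀ l, k < l → l ≤ m → x l < i) →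
      (∀ l, k < l → l ≤ m' → x l < i) → x (m + 1) = t → x (m' + 1) = t → m = m' := by
    intro k m m' h1 h2 h3 h4 h5 h6
    by_contra hne
    rcases Nat.lt_or_gt_of_ne hne with h | h
    · have := h4 (m + 1) (by omega) h; omega
    · have := h3 (m' + 1) (by omega) h; omega
  refine Set.ncard_congr (fun k hk => hk.2.2.2.choose) ?_ ?_ ?_
  · rintro k ⟨hkT, hk1, hk2, hk3⟩
    obtain ⟨h1, h2, h3, h4⟩ := hk3.choose_spec
    refine ⟨?_, h3, h4⟩
    -- A return after the exit time would put the positive point `x (firstPos x)` inside an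
    -- excursion below `i ≤ 0`.
    by_contra hT
    have := h2 _ (Nat.cast_lt.1 hkT) (not_lt.1 hT)
    have := hx.pos_firstPos
    omega
  · rintro a b ⟨haT, ha1, ha2, ha3⟩ ⟨hbT, hb1, hb2, hb3⟩ hab
    obtain ⟨h1, h2, h3, h4⟩ := ha3.choose_spec
    obtain ⟨h1', h2', h3', h4'⟩ := hb3.choose_spec
    have hab : ha3.choose = hb3.choose := hab
    rw [← hab] at h1' h2'
    by_contra hne
    rcases Nat.lt_or_gt_of_ne hne with h | h
    · have := h2 b h h1'.le; omega
    · have := h2' a h h1.le; omega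
  · rintro m ⟨hmT, hm1, hm2⟩
    -- The last time up to `m` at which the path is at or above `i`; time `0` qualifies. Downward
    -- steps have size one, so the path is at `i` at time `k` and at `i - 1` right after.
    set k := Nat.findGreatest (fun k => i ≤ x k) m with hk
    have hk1 : i ≤ x k := Nat.findGreatest_spec (P := fun k => i ≤ x k) (Nat.zero_le m)
      (by rw [hx.zero]; exact hi)
    have hk2 : ∀ l, k < l → l ≤ m → x l < i := fun l hl hlm =>
      not_le.1 (Nat.findGreatest_is_greatest hl hlm)
    have hkm : k < m := by
      refine lt_of_le_of_ne (Nat.findGreatest_le m) fun h => ?_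
      rw [h] at hk1
      omega
    have hk3 := hk2 (k + 1) (Nat.lt_succ_self k) hkm
    have hstep := hx.step k
    have hmem : ∃ m : ℕ, k < m ∧ (∀ l, k < l → l ≤ m → x l < i) ∧ x m = s ∧ x (m + 1) = t :=
      ⟨m, hkm, hk2, hm1, hm2⟩
    refine ⟨k, ⟨Nat.cast_lt.2 (hkm.trans hmT), by omega, by omega, hmem⟩, ?_⟩
    obtain ⟨h1, h2, h3, h4⟩ := hmem.choose_spec
    exact huniq h1 hkm h2 hk2 h4 hm2

/-- Only the jump at the exit time can land at a positive point, so the count is `0` or `1`. -/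
lemma finalJump_eq (hx : IsWalkPath x) {s t : ℤ} (ht : 0 < t) :
    finalJump x s t = jumpCount x s t := by
  have hlt : ∀ m, m < firstPos x → x (m + 1) = t → m + 1 = firstPos x := by
    intro m hm hmt
    by_contra hne
    have := hx.nonpos_of_lt (m := m + 1) (lt_of_le_of_ne hm hne)
    omega
  rw [finalJump, hx.T₁_eq]
  split_ifs with h
  · obtain ⟨m, hm1, hm2, hm3⟩ := h
    have hm1 : firstPos x = m + 1 := by exact_mod_cast hm1
    rw [jumpCount, hm1, Finset.sum_range_succ, if_pos ⟨hm2, hm3⟩, Finset.sum_eq_zero]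
    intro j hj
    rw [if_neg]
    rintro ⟨_, h⟩
    rw [Finset.mem_range] at hj
    have := hlt j (by omega) h
    omega
  · rw [jumpCount, Finset.sum_eq_zero]
    intro j hj
    rw [if_neg]
    rintro ⟨h1, h2⟩
    rw [Finset.mem_range] at hj
    exact h ⟨j, by rw [hlt j hj h2], h1, h2⟩

lemma U_eq (hx : IsWalkPath x) {i : ℤ} (hi : i ≤ 1) : U x i = jumpVec x i := by
  funext t
  rw [U]
  split_ifs with h
  · fin_cases t
    · exact hx.crossings_eq h (by omega) le_rfl
    · exact hx.crossings_eq h (by omega) le_rfl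
    · exact hx.crossings_eq h (by omega) (by omega)
  · obtain rfl : i = 1 := by omega
    fin_cases t
    · exact hx.finalJump_eq one_pos
    · exact hx.finalJump_eq one_pos
    · exact hx.finalJump_eq two_pos

end IsWalkPath

lemma measurable_firstPos : Measurable firstPos := by
  classical
  -- `sInf ∅ = 0`, so `firstPos` vanishes on paths that never become positive. The second
  -- alternative builds this into the predicate, which makes `Nat.find` available.
  have hp : ∀ x : ℕ → ℤ, ∃ n, 0 < x n ∨ ((∀ m, x m ≤ 0) ∧ n = 0) := by
    intro x
    by_cases h : ∃ n, 0 < x n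
    · exact ⟨h.choose, Or.inl h.choose_spec⟩
    · push Not at h
      exact ⟨0, Or.inr ⟨h, rfl⟩⟩
  have h1 : firstPos = fun x => Nat.find (hp x) := by
    funext x
    symm
    rw [Nat.find_eq_iff, firstPos]
    by_cases h : ∃ n, 0 < x n
    · refine ⟨Or.inl (Nat.sInf_mem h), fun n hn hn' => ?_⟩
      rcases hn' with hn' | ⟨hn', _⟩
      · exact Nat.notMem_of_lt_sInf hn hn'
      · obtain ⟨m, hm⟩ := h
        exact absurd (hn' m) (not_le.2 hm)
    · have hemp : {n | 0 < x n} = ∅ := Set.eq_empty_of_forall_notMem fun n hn => h ⟨n, hn⟩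
      push Not at h
      rw [hemp, Nat.sInf_empty]
      exact ⟨Or.inr ⟨h, rfl⟩, fun n hn => absurd hn (Nat.not_lt_zero n)⟩
  have hs : ∀ (S : Set ℤ) (n : ℕ), MeasurableSet {x : ℕ → ℤ | x n ∈ S} := fun S n =>
    measurable_pi_apply n (MeasurableSet.of_discrete (s := S))
  rw [h1]
  refine measurable_find hp fun n => ?_
  refine (hs (Set.Ioi 0) n).union ?_
  refine MeasurableSet.inter ?_ (MeasurableSet.const _)
  have : {x : ℕ → ℤ | ∀ m, x m ≤ 0} = ⋂ m, {x : ℕ → ℤ | x m ∈ Set.Iic (0 : ℤ)} := by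
    ext x; simp
  change MeasurableSet {x : ℕ → ℤ | ∀ m, x m ≤ 0}
  rw [this]
  exact MeasurableSet.iInter fun m => hs _ m

lemma measurable_jumpVec (i : ℤ) : Measurable fun x => jumpVec x i := by
  refine measurable_pi_lambda _ fun t => ?_
  -- The number of summands is random: it is first treated as a free countable variable, then
  -- `firstPos` is substituted.
  have h : Measurable fun z : ℕ × (ℕ → ℤ) => ∑ m ∈ Finset.range z.1,
      if z.2 m = jumpSrc i t ∧ z.2 (m + 1) = jumpDst i t then (1 : ℕ) else 0 := by
    refine measurable_from_prod_countable_right fun n => ?_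
    have hm : ∀ m, Measurable fun x : ℕ → ℤ =>
        if x m = jumpSrc i t ∧ x (m + 1) = jumpDst i t then (1 : ℕ) else 0 := fun m =>
      (measurable_of_countable (fun z : ℤ × ℤ =>
        if z.1 = jumpSrc i t ∧ z.2 = jumpDst i t then (1 : ℕ) else 0)).comp
          (by fun_prop : Measurable fun x : ℕ → ℤ => (x m, x (m + 1)))
    exact Finset.measurable_fun_sum (Finset.range n) fun m _ => hm m
  exact h.comp (measurable_firstPos.prodMk measurable_id)

/-! ### Multiplicative weights and the length of the path -/

/-- The step weights whose product along a path is `∏ s(i, t) ^ U_t(i)`. -/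
noncomputable def genWeight (s : ℤ → Fin 3 → ℝ≥0∞) (y y' : ℤ) : ℝ≥0∞ :=
  if y' = y + 1 then s (y + 1) 0 else if y' = y + 2 then s (y + 2) 1 * s (y + 1) 2 else 1

lemma prod_pow_ite {f : ℤ → ℝ≥0∞} {n : ℕ} (hf : ∀ i, (∀ m ≤ n, i ≠ 1 - (m : ℤ)) → f i = 1)
    (j : ℤ) :
    ∏ m ∈ Finset.range (n + 1), f (1 - (m : ℤ)) ^ (if j = 1 - (m : ℤ) then 1 else 0) = f j := by
  by_cases h : ∃ m ≤ n, j = 1 - (m : ℤ)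
  · obtain ⟨m, hm, rfl⟩ := h
    rw [Finset.prod_eq_single m]
    · simp
    · intro b _ hb
      rw [if_neg (by omega), pow_zero]
    · intro h
      exact absurd (Finset.mem_range.2 (by omega)) h
  · push Not at h
    rw [hf j h]
    refine Finset.prod_eq_one fun m hm => ?_
    rw [if_neg (h m (by rw [Finset.mem_range] at hm; omega)), pow_zero]

/-- A jump by `1` is marked once, as component `0` at level `y + 1`. A jump by `2` is marked twice,
as component `1` at level `y + 2` and as component `2` at level `y + 1`. -/
lemma genWeight_eq_prod {s : ℤ → Fin 3 → ℝ≥0∞} {n : ℕ}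
    (hs : ∀ i, (∀ m ≤ n, i ≠ 1 - (m : ℤ)) → s i = 1) {y y' : ℤ}
    (h : y' = y - 1 ∨ y' = y + 1 ∨ y' = y + 2) :
    genWeight s y y' = ∏ m ∈ Finset.range (n + 1), ∏ t, s (1 - (m : ℤ)) t ^
      jumpMark y y' (1 - (m : ℤ)) t := by
  have hs' : ∀ t i, (∀ m ≤ n, i ≠ 1 - (m : ℤ)) → (fun i => s i t) i = 1 := fun t i hi => by
    simp [hs i hi]
  simp only [Fin.prod_univ_three, Finset.prod_mul_distrib, jumpMark_zero, jumpMark_one,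
    jumpMark_two]
  rcases h with rfl | rfl | rfl
  · rw [genWeight, if_neg (by omega), if_neg (by omega)]
    rw [Finset.prod_eq_one, Finset.prod_eq_one, Finset.prod_eq_one]
    · simp
    all_goals
      intro m _
      rw [if_neg (by omega), pow_zero]
  · rw [genWeight, if_pos rfl, ← prod_pow_ite (hs' 0) (y + 1)]
    rw [Finset.prod_eq_one (f := fun m : ℕ => s (1 - (m : ℤ)) 1 ^ _),
      Finset.prod_eq_one (f := fun m : ℕ => s (1 - (m : ℤ)) 2 ^ _)]
    · rw [mul_one, mul_one]
      refine Finset.prod_congr rfl fun m _ => ?_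
      congr 1
      exact if_congr (by omega) rfl rfl
    all_goals
      intro m _
      rw [if_neg (by omega), pow_zero]
  · rw [genWeight, if_neg (by omega), if_pos rfl, ← prod_pow_ite (hs' 1) (y + 2),
      ← prod_pow_ite (hs' 2) (y + 1),
      Finset.prod_eq_one (f := fun m : ℕ => s (1 - (m : ℤ)) 0 ^ _)]
    · rw [one_mul]
      congr 1 <;>
      · refine Finset.prod_congr rfl fun m _ => ?_
        congr 1
        exact if_congr (by omega) rfl rfl
    · intro m _
      rw [if_neg (by omega), pow_zero]

lemma IsWalkPath.prod_genWeight {x : ℕ → ℤ} (hx : IsWalkPath x) {s : ℤ → Fin 3 → ℝ≥0∞} {n : ℕ}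
    (hs : ∀ i, (∀ m ≤ n, i ≠ 1 - (m : ℤ)) → s i = 1) :
    ∏ k ∈ Finset.range (firstPos x), genWeight s (x k) (x (k + 1)) =
      ∏ m ∈ Finset.range (n + 1), ∏ t, s (1 - (m : ℤ)) t ^ jumpVec x (1 - (m : ℤ)) t := by
  simp only [genWeight_eq_prod hs (hx.step _), jumpVec_eq, ← Finset.prod_pow_eq_pow_sum]
  rw [Finset.prod_comm]
  refine Finset.prod_congr rfl fun m _ => ?_
  rw [Finset.prod_comm]

lemma tsum_ite_eq_neg (j : ℤ) (c : ℝ≥0∞) :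
    ∑' n : ℕ, (if j = -(n : ℤ) then c else 0) = if j ≤ 0 then c else 0 := by
  by_cases h : j ≤ 0
  · rw [if_pos h, tsum_eq_single j.natAbs, if_pos (by omega)]
    intro n hn
    rw [if_neg (by omega)]
  · rw [if_neg h]
    refine ENNReal.tsum_eq_zero.2 fun n => ?_
    rw [if_neg (by omega)]

/-- The contribution of a step to `∑ (2 A(i) + 2 B(i) + C(i))`. -/
def stepCost (y y' : ℤ) : ℕ :=
  if y' = y - 1 then 0 else if y' = y + 1 then (if y + 1 ≤ 0 then 2 else 0)
  else (if y + 2 ≤ 0 then 2 else 0) + (if y + 1 ≤ 0 then 1 else 0)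

lemma tsum_stepCost {y y' : ℤ} (h : y' = y - 1 ∨ y' = y + 1 ∨ y' = y + 2) :
    ∑' n : ℕ, ∑ t, (![2, 2, 1] : Fin 3 → ℝ≥0∞) t * (jumpMark y y' (-(n : ℤ)) t : ℝ≥0∞) =
      stepCost y y' := by
  simp only [Fin.sum_univ_three, jumpMark_zero, jumpMark_one, jumpMark_two, Nat.cast_ite,
    Nat.cast_one, Nat.cast_zero, mul_ite, mul_one, mul_zero]
  simp only [Matrix.cons_val_zero, Matrix.cons_val_one, Matrix.cons_val]
  rw [ENNReal.tsum_add, ENNReal.tsum_add]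
  have hz : ∀ (p : ℕ → Prop) [DecidablePred p] (c : ℝ≥0∞), (∀ n, ¬ p n) →
      ∑' n, (if p n then c else 0) = 0 := fun p _ c hp => by simp [hp]
  have hc : ∀ (p : ℕ → Prop) [DecidablePred p] (c : ℝ≥0∞) (j : ℤ), (∀ n : ℕ, p n ↔ j = -(n : ℤ)) →
      ∑' n, (if p n then c else 0) = if j ≤ 0 then c else 0 := fun p _ c j hp => by
    rw [← tsum_ite_eq_neg]
    exact tsum_congr fun n => if_congr (hp n) rfl rfl
  rcases h with rfl | rfl | rfl
  · rw [hz _ _ fun n => by omega, hz _ _ fun n => by omega, hz _ _ fun n => by omega, stepCost,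
      if_pos rfl]
    simp
  · have e : stepCost y (y + 1) = if y + 1 ≤ 0 then 2 else 0 := by
      rw [stepCost, if_neg (by omega), if_pos rfl]
    rw [hc _ _ (y + 1) fun n => by omega, hz _ _ fun n => by omega, hz _ _ fun n => by omega, e]
    simp
  · have e : stepCost y (y + 2) = (if y + 2 ≤ 0 then 2 else 0) + (if y + 1 ≤ 0 then 1 else 0) := by
      rw [stepCost, if_neg (by omega), if_neg (by omega)]
    rw [hz _ _ fun n => by omega, hc _ _ (y + 2) fun n => by omega,
      hc _ _ (y + 1) fun n => by omega, e]
    push_cast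
    simp

lemma IsWalkPath.T₁_eq_tsum {x : ℕ → ℤ} (hx : IsWalkPath x) :
    (T₁ x : ℝ≥0∞) =
      1 + ∑' n : ℕ, ∑ t, (![2, 2, 1] : Fin 3 → ℝ≥0∞) t * (jumpVec x (-(n : ℤ)) t : ℝ≥0∞) := by
  have h1 : ∑' n : ℕ, ∑ t, (![2, 2, 1] : Fin 3 → ℝ≥0∞) t * (jumpVec x (-(n : ℤ)) t : ℝ≥0∞) =
      ((∑ m ∈ Finset.range (firstPos x), stepCost (x m) (x (m + 1)) : ℕ) : ℝ≥0∞) := by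
    rw [Nat.cast_sum]
    simp only [← tsum_stepCost (hx.step _), jumpVec_eq]
    rw [← Summable.tsum_finsetSum fun _ _ => ENNReal.summable]
    refine tsum_congr fun n => ?_
    rw [Finset.sum_comm]
    refine Finset.sum_congr rfl fun t _ => ?_
    rw [Nat.cast_sum, Finset.mul_sum]
  -- A step costs `1` plus the increment of the position, provided the positive exit point is
  -- replaced by `-1`; this value is right for all three final jumps `0 → 1`, `-1 → 1`, `0 → 2`. The
  -- sum telescopes to `firstPos x - 1`.
  have h2 : ∀ m ∈ Finset.range (firstPos x), (stepCost (x m) (x (m + 1)) : ℤ) =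
      1 + ((if x (m + 1) ≤ 0 then x (m + 1) else -1) - (if x m ≤ 0 then x m else -1)) := by
    intro m hm
    have := hx.nonpos_of_lt (Finset.mem_range.1 hm)
    rw [if_pos this, stepCost]
    rcases hx.step m with h | h | h <;> rw [h] <;> split_ifs <;> omega
  have h3 : (∑ m ∈ Finset.range (firstPos x), stepCost (x m) (x (m + 1)) : ℕ) + 1 = firstPos x := by
    have : ((∑ m ∈ Finset.range (firstPos x), stepCost (x m) (x (m + 1)) : ℕ) : ℤ) + 1
        = firstPos x := by
      rw [Nat.cast_sum, Finset.sum_congr rfl h2, Finset.sum_add_distrib,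
        Finset.sum_range_sub (fun m => if x m ≤ 0 then x m else -1), hx.zero,
        if_neg (not_le.2 hx.pos_firstPos)]
      simp
    exact_mod_cast this
  rw [h1, hx.T₁_eq, add_comm]
  have h4 := congrArg (Nat.cast : ℕ → ℝ≥0∞) h3
  rw [Nat.cast_add, Nat.cast_one] at h4
  rw [h4]
  rfl

/-! ### The exit generating functions -/

/-- The exit probability at `k + j` weighted by `∏ s(i, t) ^ U_t(i)`. -/
noncomputable def exitGen (ω : Env) (s : ℤ → Fin 3 → ℝ) (k j : ℤ) : ℝ :=
  (exitAt ω (genWeight fun i t => ENNReal.ofReal (s i t)) k j).toReal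

/-- Arguments of probability generating functions. -/
def IsUnitArg (s : ℤ → Fin 3 → ℝ) : Prop := ∀ i t, 0 ≤ s i t ∧ s i t ≤ 1

/-- All three jumps have positive probability at every site. -/
structure IsPositiveEnv (ω : Env) : Prop where
  q_pos : ∀ x, 0 < q ω x
  p₁_pos : ∀ x, 0 < p₁ ω x
  p₂_pos : ∀ x, 0 < p₂ ω x

lemma genWeight_le_one {s : ℤ → Fin 3 → ℝ} (hs : IsUnitArg s) (y y' : ℤ) :
    genWeight (fun i t => ENNReal.ofReal (s i t)) y y' ≤ 1 := by
  have h : ∀ i t, ENNReal.ofReal (s i t) ≤ 1 := fun i t =>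
    ENNReal.ofReal_le_one.2 (hs i t).2
  unfold genWeight
  split_ifs
  · exact h _ _
  · exact mul_le_one' (h _ _) (h _ _)
  · exact le_rfl

lemma exitAt_genWeight_ne_top (ω : Env) {s : ℤ → Fin 3 → ℝ} (hs : IsUnitArg s) (k j : ℤ) :
    exitAt ω (genWeight fun i t => ENNReal.ofReal (s i t)) k j ≠ ∞ :=
  ne_top_of_le_ne_top ENNReal.one_ne_top (exitAt_le_one ω (genWeight_le_one hs) k j)

lemma exitGen_nonneg (ω : Env) (s : ℤ → Fin 3 → ℝ) (k j : ℤ) : 0 ≤ exitGen ω s k j :=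
  ENNReal.toReal_nonneg

lemma exitGen_le_one (ω : Env) {s : ℤ → Fin 3 → ℝ} (hs : IsUnitArg s) (k j : ℤ) :
    exitGen ω s k j ≤ 1 :=
  ENNReal.toReal_le_of_le_ofReal zero_le_one
    (by simpa using exitAt_le_one ω (genWeight_le_one hs) k j)

lemma exitGen_one (ω : Env) {s : ℤ → Fin 3 → ℝ} (hs : IsUnitArg s) (k : ℤ) :
    exitGen ω s k 1 = q ω k * (exitGen ω s (k - 1) 1 * exitGen ω s k 1 + exitGen ω s (k - 1) 2)
      + p₁ ω k * s (k + 1) 0 := by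
  have h := fun k j => exitAt_genWeight_ne_top ω hs k j
  have e := congrArg ENNReal.toReal
    (exitAt_one ω k (genWeight fun i t => ENNReal.ofReal (s i t)))
  rw [ENNReal.toReal_add (by
      refine ENNReal.mul_ne_top (ENNReal.mul_ne_top ENNReal.ofReal_ne_top ?_)
        (ENNReal.add_ne_top.2 ⟨ENNReal.mul_ne_top (h _ _) (h _ _), h _ _⟩)
      exact ne_top_of_le_ne_top ENNReal.one_ne_top (genWeight_le_one hs _ _))
    (ENNReal.mul_ne_top ENNReal.ofReal_ne_top
      (ne_top_of_le_ne_top ENNReal.one_ne_top (genWeight_le_one hs _ _))),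
    ENNReal.toReal_mul, ENNReal.toReal_mul, ENNReal.toReal_mul,
    ENNReal.toReal_add (ENNReal.mul_ne_top (h _ _) (h _ _)) (h _ _), ENNReal.toReal_mul,
    ENNReal.toReal_ofReal (q_nonneg ω k), ENNReal.toReal_ofReal (p₁_nonneg ω k)] at e
  have g1 : genWeight (fun i t => ENNReal.ofReal (s i t)) k (k - 1) = 1 := by
    rw [genWeight, if_neg (by omega), if_neg (by omega)]
  have g2 : genWeight (fun i t => ENNReal.ofReal (s i t)) k (k + 1)
      = ENNReal.ofReal (s (k + 1) 0) := by
    rw [genWeight, if_pos rfl]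
  rw [g1, g2, ENNReal.toReal_one, mul_one, ENNReal.toReal_ofReal (hs _ _).1] at e
  exact e

lemma exitGen_two (ω : Env) {s : ℤ → Fin 3 → ℝ} (hs : IsUnitArg s) (k : ℤ) :
    exitGen ω s k 2 = q ω k * (exitGen ω s (k - 1) 1 * exitGen ω s k 2)
      + p₂ ω k * (s (k + 2) 1 * s (k + 1) 2) := by
  have h := fun k j => exitAt_genWeight_ne_top ω hs k j
  have e := congrArg ENNReal.toReal
    (exitAt_two ω k (genWeight fun i t => ENNReal.ofReal (s i t)))
  rw [ENNReal.toReal_add (by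
      refine ENNReal.mul_ne_top (ENNReal.mul_ne_top ENNReal.ofReal_ne_top ?_)
        (ENNReal.mul_ne_top (h _ _) (h _ _))
      exact ne_top_of_le_ne_top ENNReal.one_ne_top (genWeight_le_one hs _ _))
    (ENNReal.mul_ne_top ENNReal.ofReal_ne_top
      (ne_top_of_le_ne_top ENNReal.one_ne_top (genWeight_le_one hs _ _))),
    ENNReal.toReal_mul, ENNReal.toReal_mul, ENNReal.toReal_mul, ENNReal.toReal_mul,
    ENNReal.toReal_ofReal (q_nonneg ω k), ENNReal.toReal_ofReal (p₂_nonneg ω k)] at e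
  have g1 : genWeight (fun i t => ENNReal.ofReal (s i t)) k (k - 1) = 1 := by
    rw [genWeight, if_neg (by omega), if_neg (by omega)]
  have g2 : genWeight (fun i t => ENNReal.ofReal (s i t)) k (k + 2)
      = ENNReal.ofReal (s (k + 2) 1) * ENNReal.ofReal (s (k + 1) 2) := by
    rw [genWeight, if_neg (by omega), if_pos rfl]
  rw [g1, g2, ENNReal.toReal_one, mul_one, ENNReal.toReal_mul,
    ENNReal.toReal_ofReal (hs _ _).1, ENNReal.toReal_ofReal (hs _ _).1] at e
  exact e

/-- Steps before the exit start at or below `k`, so only marks at levels up to `k + 2` are seen. -/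
lemma exitGen_eq_exitProb (ω : Env) {s : ℤ → Fin 3 → ℝ} {k : ℤ} (hs : ∀ i ≤ k + 2, s i = 1)
    (j : ℤ) : exitGen ω s k j = exitProb ω k j := by
  rw [exitGen, exitProb_eq, exitAt_congr ω j (g' := 1)]
  intro y hy
  funext y'
  rw [genWeight, hs (y + 1) (by omega), hs (y + 2) (by omega)]
  simp

lemma isUnitArg_one : IsUnitArg 1 := fun _ _ => by simp

/-! ### Closed forms of the exit functions and of `α`, `β`, `γ` -/

namespace IsPositiveEnv

variable {ω : Env}

lemma q_lt_one (hω : IsPositiveEnv ω) (k : ℤ) : q ω k < 1 := by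
  have := q_add_p₁_add_p₂ ω k
  linarith [hω.p₁_pos k, hω.p₂_pos k]

lemma one_sub_pos (hω : IsPositiveEnv ω) {s : ℤ → Fin 3 → ℝ} (hs : IsUnitArg s) (k j : ℤ) :
    0 < 1 - q ω k * exitGen ω s j 1 := by
  have := mul_le_of_le_one_right (hω.q_pos k).le (exitGen_le_one ω hs j 1)
  linarith [hω.q_lt_one k]

lemma exitGen_one_eq_div (hω : IsPositiveEnv ω) {s : ℤ → Fin 3 → ℝ} (hs : IsUnitArg s) (k : ℤ) :
    exitGen ω s k 1 = (p₁ ω k * s (k + 1) 0 + q ω k * exitGen ω s (k - 1) 2) /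
      (1 - q ω k * exitGen ω s (k - 1) 1) := by
  rw [eq_div_iff (hω.one_sub_pos hs k _).ne']
  linear_combination exitGen_one ω hs k

lemma exitGen_two_eq_div (hω : IsPositiveEnv ω) {s : ℤ → Fin 3 → ℝ} (hs : IsUnitArg s) (k : ℤ) :
    exitGen ω s k 2 = p₂ ω k * (s (k + 2) 1 * s (k + 1) 2) /
      (1 - q ω k * exitGen ω s (k - 1) 1) := by
  rw [eq_div_iff (hω.one_sub_pos hs k _).ne']
  linear_combination exitGen_two ω hs k

lemma one_sub_mul_exitProb_pos (hω : IsPositiveEnv ω) (k j : ℤ) : 0 < 1 - q ω k * exitProb ω j 1 := by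
  rw [← exitGen_eq_exitProb ω (s := 1) fun _ _ => rfl]
  exact hω.one_sub_pos isUnitArg_one k j

lemma exitProb_one_eq_div (hω : IsPositiveEnv ω) (k : ℤ) :
    exitProb ω k 1 = (p₁ ω k + γ ω k) / (1 - q ω k * exitProb ω (k - 1) 1) := by
  have := hω.exitGen_one_eq_div isUnitArg_one k
  simp only [exitGen_eq_exitProb ω (s := 1) fun _ _ => rfl] at this
  simpa [γ] using this

lemma exitProb_two_eq_div (hω : IsPositiveEnv ω) (k : ℤ) :
    exitProb ω k 2 = p₂ ω k / (1 - q ω k * exitProb ω (k - 1) 1) := by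
  have := hω.exitGen_two_eq_div isUnitArg_one k
  simp only [exitGen_eq_exitProb ω (s := 1) fun _ _ => rfl] at this
  simpa using this

lemma γ_pos (hω : IsPositiveEnv ω) (k : ℤ) : 0 < γ ω k := by
  rw [γ, hω.exitProb_two_eq_div]
  exact mul_pos (hω.q_pos k) (div_pos (hω.p₂_pos _) (hω.one_sub_mul_exitProb_pos _ _))

lemma p₁_add_γ_pos (hω : IsPositiveEnv ω) (k : ℤ) : 0 < p₁ ω k + γ ω k := add_pos (hω.p₁_pos k) (hω.γ_pos k)

/-- The recursion for `exitProb` cancels the normalisation `p₁ + γ`; what remains is the coefficient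
that appears in the recursion for `exitGen`. -/
lemma α_eq (hω : IsPositiveEnv ω) (k : ℤ) :
    α ω k = q ω k * p₁ ω (k - 1) / (1 - q ω (k - 1) * exitProb ω (k - 1 - 1) 1) := by
  have h1 := (hω.one_sub_mul_exitProb_pos (k - 1) (k - 1 - 1)).ne'
  have h2 := (hω.p₁_add_γ_pos (k - 1)).ne'
  rw [α, hω.exitProb_one_eq_div]
  field_simp

lemma β_eq (hω : IsPositiveEnv ω) (k : ℤ) :
    β ω k = q ω k * γ ω (k - 1) / (1 - q ω (k - 1) * exitProb ω (k - 1 - 1) 1) := by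
  have h1 := (hω.one_sub_mul_exitProb_pos (k - 1) (k - 1 - 1)).ne'
  have h2 := (hω.p₁_add_γ_pos (k - 1)).ne'
  rw [β, hω.exitProb_one_eq_div]
  field_simp

lemma α_pos (hω : IsPositiveEnv ω) (k : ℤ) : 0 < α ω k := by
  rw [hω.α_eq]
  exact div_pos (mul_pos (hω.q_pos _) (hω.p₁_pos _)) (hω.one_sub_mul_exitProb_pos _ _)

lemma β_pos (hω : IsPositiveEnv ω) (k : ℤ) : 0 < β ω k := by
  rw [hω.β_eq]
  exact div_pos (mul_pos (hω.q_pos _) (hω.γ_pos _)) (hω.one_sub_mul_exitProb_pos _ _)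

lemma α_add_β (hω : IsPositiveEnv ω) (k : ℤ) : α ω k + β ω k = q ω k * exitProb ω (k - 1) 1 := by
  rw [hω.α_eq, hω.β_eq, hω.exitProb_one_eq_div (k - 1)]
  ring

/-- The two fractions defining `α` and `β` add up to one, so `α + β` is `q` times an exit
probability, at most `q < 1`. -/
lemma one_sub_α_sub_β_pos (hω : IsPositiveEnv ω) (k : ℤ) : 0 < 1 - α ω k - β ω k := by
  have := hω.α_add_β k
  have := hω.one_sub_mul_exitProb_pos k (k - 1)
  linarith

lemma one_sub_gen_pos (hω : IsPositiveEnv ω) (k : ℤ) {a b : ℝ} (ha : a ≤ 1) (hb : b ≤ 1) :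
    0 < 1 - α ω k * a - β ω k * b := by
  have := hω.one_sub_α_sub_β_pos k
  have := mul_le_of_le_one_right (hω.α_pos k).le ha
  have := mul_le_of_le_one_right (hω.β_pos k).le hb
  linarith

/-- Exit generating functions when only levels `≥ j` are recorded. -/
lemma exitGen_lowest (hω : IsPositiveEnv ω) {s : ℤ → Fin 3 → ℝ} (hs : IsUnitArg s) {j : ℤ} (hj : ∀ i < j, s i = 1) :
    exitGen ω s j 1 = (p₁ ω j * s (j + 1) 0 + γ ω j * (s (j + 1) 1 * s j 2)) /
        (1 - α ω j * s j 0 - β ω j * s j 1) ∧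
      exitGen ω s j 2 = p₂ ω j * (s (j + 2) 1 * s (j + 1) 2) /
        (1 - α ω j * s j 0 - β ω j * s j 1) := by
  -- Exits from level `k` see marks up to `k + 2`, so `j - 3` is the highest level at which no mark
  -- of level `j` is visible. At `j - 2` only `s j 1` appears; at `j - 1` the other two join.
  have e1 : exitGen ω s (j - 1 - 1 - 1) 1 = exitProb ω (j - 1 - 1 - 1) 1 :=
    exitGen_eq_exitProb ω (fun i hi => hj i (by omega)) 1
  have e2 : exitGen ω s (j - 1 - 1 - 1) 2 = exitProb ω (j - 1 - 1 - 1) 2 :=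
    exitGen_eq_exitProb ω (fun i hi => hj i (by omega)) 2
  have e3 : exitGen ω s (j - 1 - 1) 1 = exitProb ω (j - 1 - 1) 1 := by
    rw [hω.exitGen_one_eq_div hs, e1, e2, hω.exitProb_one_eq_div (j - 1 - 1), hj (j - 1 - 1 + 1) (by omega), γ]
    simp
  have e4 : exitGen ω s (j - 1 - 1) 2 = exitProb ω (j - 1 - 1) 2 * s j 1 := by
    rw [hω.exitGen_two_eq_div hs, e1, hω.exitProb_two_eq_div (j - 1 - 1), hj (j - 1 - 1 + 1) (by omega),
      show j - 1 - 1 + 2 = j by ring]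
    simp only [Pi.one_apply]
    ring
  have e5 : q ω j * exitGen ω s (j - 1) 1 = α ω j * s j 0 + β ω j * s j 1 := by
    rw [hω.exitGen_one_eq_div hs, e3, e4, hω.α_eq, hω.β_eq, γ, show j - 1 + 1 = j by ring]
    ring
  have e6 : q ω j * exitGen ω s (j - 1) 2 = γ ω j * (s (j + 1) 1 * s j 2) := by
    rw [hω.exitGen_two_eq_div hs, e3, γ, hω.exitProb_two_eq_div, show j - 1 + 1 = j by ring,
      show j - 1 + 2 = j + 1 by ring]
    ring
  rw [hω.exitGen_one_eq_div hs j, hω.exitGen_two_eq_div hs j, e5, e6, sub_sub]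
  exact ⟨rfl, rfl⟩

end IsPositiveEnv

/-- The generating function of the offspring in generation `j` of an individual of type `k`. -/
noncomputable def offspringGen (ω : Env) (j : ℤ) (v : Fin 3 → ℝ) (k : Fin 3) : ℝ :=
  (1 - α ω j - β ω j) / (1 - α ω j * v 0 - β ω j * v 1) * ![1, v 2, 1] k

/-- The argument `s` with level `j` absorbed into level `j + 1` through the offspring generating
function. -/
noncomputable def absorb (ω : Env) (j : ℤ) (s : ℤ → Fin 3 → ℝ) : ℤ → Fin 3 → ℝ := fun i =>
  if i = j then 1 else if i = j + 1 then s i * offspringGen ω j (s j) else s i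

/-! ### Erasing the lowest recorded level -/

namespace IsPositiveEnv

variable {ω : Env}

lemma offspringGen_mem (hω : IsPositiveEnv ω) (j : ℤ) {v : Fin 3 → ℝ} (hv : ∀ t, 0 ≤ v t ∧ v t ≤ 1) (k : Fin 3) :
    0 ≤ offspringGen ω j v k ∧ offspringGen ω j v k ≤ 1 := by
  have h1 := hω.one_sub_gen_pos j (hv 0).2 (hv 1).2
  have h2 := hω.one_sub_α_sub_β_pos j
  have h3 : (1 - α ω j - β ω j) / (1 - α ω j * v 0 - β ω j * v 1) ≤ 1 := by
    rw [div_le_one h1]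
    linarith [mul_le_of_le_one_right (hω.α_pos j).le (hv 0).2,
      mul_le_of_le_one_right (hω.β_pos j).le (hv 1).2]
  have h4 := (div_pos h2 h1).le
  have h5 : 0 ≤ (![1, v 2, 1] : Fin 3 → ℝ) k ∧ (![1, v 2, 1] : Fin 3 → ℝ) k ≤ 1 := by
    fin_cases k
    · simp
    · simpa using hv 2
    · simp
  exact ⟨mul_nonneg h4 h5.1, mul_le_one₀ h3 h5.1 h5.2⟩

lemma isUnitArg_absorb (hω : IsPositiveEnv ω) {s : ℤ → Fin 3 → ℝ} (hs : IsUnitArg s) (j : ℤ) :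
    IsUnitArg (absorb ω j s) := by
  intro i t
  unfold absorb
  split_ifs
  · simp
  · have := hω.offspringGen_mem j (hs j) t
    exact ⟨mul_nonneg (hs _ _).1 this.1, mul_le_one₀ (hs _ _).2 this.1 this.2⟩
  · exact hs i t

/-- Absorbing the lowest recorded level does not change the exit generating functions. -/
lemma exitGen_absorb (hω : IsPositiveEnv ω) {s : ℤ → Fin 3 → ℝ} (hs : IsUnitArg s) {j : ℤ} (hj : ∀ i < j, s i = 1)
    (n : ℕ) : exitGen ω (absorb ω j s) (j + n) 1 = exitGen ω s (j + n) 1 ∧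
      exitGen ω (absorb ω j s) (j + n) 2 = exitGen ω s (j + n) 2 := by
  have hs' := hω.isUnitArg_absorb hs j
  induction n with
  | zero =>
    have hj' : ∀ i < j, absorb ω j s i = 1 := fun i hi => by
      rw [absorb, if_neg (by omega), if_neg (by omega), hj i hi]
    have a0 : absorb ω j s j = 1 := by rw [absorb, if_pos rfl]
    have a1 : absorb ω j s (j + 1) = s (j + 1) * offspringGen ω j (s j) := by
      rw [absorb, if_neg (by omega), if_pos rfl]
    have a2 : absorb ω j s (j + 2) = s (j + 2) := by
      rw [absorb, if_neg (by omega), if_neg (by omega)]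
    have h1 := (hω.one_sub_gen_pos j (hs j 0).2 (hs j 1).2).ne'
    have h2 := (hω.one_sub_α_sub_β_pos j).ne'
    have h3 := hω.exitGen_lowest hs hj
    have h4 := hω.exitGen_lowest hs' hj'
    rw [a0, a1, a2] at h4
    simp only [Pi.mul_apply, Pi.one_apply, offspringGen, mul_one] at h4
    simp only [Matrix.cons_val_zero, Matrix.cons_val_one, Matrix.cons_val] at h4
    -- Each numerator term carries exactly one mark of level `j + 1`, so multiplying that mark by
    -- `offspringGen` restores the denominator and the factor `s j 2`.
    rw [Nat.cast_zero, add_zero, h3.1, h3.2, h4.1, h4.2]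
    constructor <;> field_simp
  | succ n ih =>
    -- Above `j` the recursion uses marks of levels at least `j + 2` and the exit functions one
    -- level below, all unchanged.
    have e : j + ((n + 1 : ℕ) : ℤ) - 1 = j + n := by push_cast; ring
    have a1 : absorb ω j s (j + ((n + 1 : ℕ) : ℤ) + 1) = s (j + ((n + 1 : ℕ) : ℤ) + 1) := by
      rw [absorb, if_neg (by omega), if_neg (by omega)]
    have a2 : absorb ω j s (j + ((n + 1 : ℕ) : ℤ) + 2) = s (j + ((n + 1 : ℕ) : ℤ) + 2) := by
      rw [absorb, if_neg (by omega), if_neg (by omega)]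
    have h1 := fun s hs => hω.exitGen_one_eq_div (s := s) hs (j + ((n + 1 : ℕ) : ℤ))
    have h2 := fun s hs => hω.exitGen_two_eq_div (s := s) hs (j + ((n + 1 : ℕ) : ℤ))
    rw [h1 _ hs', h2 _ hs', h1 _ hs, h2 _ hs, e, ih.1, ih.2, a1, a2]
    exact ⟨rfl, rfl⟩

end IsPositiveEnv

/-! ### The joint generating function of the branching structure -/

lemma ae_isWalkPath {ω : Env} (hexit : ∀ᵐ x ∂quenched ω 0, ∃ n, 0 < x n) :
    ∀ᵐ x ∂quenched ω 0, IsWalkPath x := by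
  filter_upwards [hexit, ae_quenched_zero ω 0, ae_quenched_step ω 0] with x h1 h2 h3
    using ⟨h2, h3, h1⟩

/-- Almost every path becomes positive, so the monomial is the full path weight with boundary value
`1`, and its mean is the sum over the two exit points. -/
lemma lintegral_prod_pow_jumpVec {ω : Env} (hexit : ∀ᵐ x ∂quenched ω 0, ∃ n, 0 < x n)
    {s : ℤ → Fin 3 → ℝ} (hs : IsUnitArg s) {n : ℕ}
    (hn : ∀ i, (∀ m ≤ n, i ≠ 1 - (m : ℤ)) → s i = 1) :
    ∫⁻ x, ∏ m ∈ Finset.range (n + 1), ∏ t,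
        ENNReal.ofReal (s (1 - (m : ℤ)) t) ^ jumpVec x (1 - (m : ℤ)) t ∂quenched ω 0 =
      ENNReal.ofReal (exitGen ω s 0 1 + exitGen ω s 0 2) := by
  rw [ENNReal.ofReal_add (exitGen_nonneg _ _ _ _) (exitGen_nonneg _ _ _ _), exitGen, exitGen,
    ENNReal.ofReal_toReal (exitAt_genWeight_ne_top ω hs _ _),
    ENNReal.ofReal_toReal (exitAt_genWeight_ne_top ω hs _ _)]
  have h := exitSum_self ω 0 (genWeight fun i t => ENNReal.ofReal (s i t)) 1
  simp only [Pi.one_apply, mul_one] at h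
  rw [← h, ← lintegral_iSup_pathWeight]
  refine lintegral_congr_ae ?_
  filter_upwards [ae_isWalkPath hexit] with x hx
  rw [iSup_pathWeight _ _ (fun m hm => hx.nonpos_of_lt hm) hx.pos_firstPos,
    hx.prod_genWeight (n := n) fun i hi => funext fun t => by simp [hn i hi]]
  simp

/-! ### Uniqueness of generating functions and the branching property -/

open BoundedContinuousFunction in
/-- Finite measures on a countable space which integrate every element of a point-separating
multiplicative family of `[0, 1]`-valued functions equally are equal. -/
lemma measure_ext_of_submonoid {E : Type*} [Countable E] [MeasurableSpace E]
    [DiscreteMeasurableSpace E] {μ ν : Measure E} [IsFiniteMeasure μ] [IsFiniteMeasure ν]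
    (S : Submonoid (E → ℝ)) (hS : ∀ f ∈ S, ∀ x, 0 ≤ f x ∧ f x ≤ 1)
    (hsep : ∀ x y, x ≠ y → ∃ f ∈ S, f x ≠ f y)
    (h : ∀ f ∈ S, ∫⁻ x, ENNReal.ofReal (f x) ∂μ = ∫⁻ x, ENNReal.ofReal (f x) ∂ν) : μ = ν := by
  let : TopologicalSpace E := ⊥
  have : DiscreteTopology E := ⟨rfl⟩
  have : BorelSpace E := ⟨by
    ext s
    refine ⟨fun _ => MeasurableSpace.measurableSet_generateFrom (isOpen_discrete s),
      fun _ => MeasurableSet.of_discrete⟩⟩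
  -- In the discrete topology all functions are continuous, so `S` becomes a family of bounded
  -- continuous functions whose algebra separates points.
  let T : Submonoid (E →ᵇ ℝ) :=
    { carrier := {g | ⇑g ∈ S}
      mul_mem' := fun {a b} ha hb => by
        have : ⇑(a * b) = ⇑a * ⇑b := rfl
        rw [Set.mem_ofPred_eq, this]
        exact S.mul_mem ha hb
      one_mem' := S.one_mem }
  let A : StarSubalgebra ℝ (E →ᵇ ℝ) :=
    { Algebra.adjoin ℝ (T : Set (E →ᵇ ℝ)) with
      star_mem' := fun {a} ha => by
        have : star a = a := by ext x; simp
        rw [this]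
        exact ha }
  have hT : ∀ f ∈ S, ∃ g ∈ T, ⇑g = f := by
    intro f hf
    refine ⟨BoundedContinuousFunction.ofNormedAddCommGroup f continuous_of_discreteTopology 1
      fun x => ?_, ?_, rfl⟩
    · rw [Real.norm_of_nonneg (hS f hf x).1]
      exact (hS f hf x).2
    · exact hf
  refine ext_of_forall_mem_subalgebra_integral_eq_of_polish (𝕜 := ℝ) (A := A) ?_ ?_
  · intro x y hxy
    obtain ⟨f, hf, hne⟩ := hsep x y hxy
    obtain ⟨g, hg, rfl⟩ := hT f hf
    exact ⟨g, ⟨⟨g, continuous_of_discreteTopology⟩, ⟨g, Algebra.subset_adjoin hg, rfl⟩, rfl⟩, hne⟩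
  · intro g hg
    -- A multiplicatively closed family generates its linear span as an algebra, so equality of
    -- integrals extends by linearity.
    replace hg : g ∈ Submodule.span ℝ (T : Set (E →ᵇ ℝ)) := by
      have h1 : g ∈ Subalgebra.toSubmodule (Algebra.adjoin ℝ (T : Set (E →ᵇ ℝ))) := hg
      rwa [Algebra.adjoin_eq_span, Submonoid.closure_eq] at h1
    induction hg using Submodule.span_induction with
    | mem g hg =>
      have hnn : ∀ x, 0 ≤ g x := fun x => (hS _ hg x).1
      have hm : Measurable g := measurable_of_countable _
      rw [integral_eq_lintegral_of_nonneg_ae (ae_of_all _ hnn) hm.aestronglyMeasurable,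
        integral_eq_lintegral_of_nonneg_ae (ae_of_all _ hnn) hm.aestronglyMeasurable, h _ hg]
    | zero => simp
    | add a b _ _ ha hb =>
      have : ∀ x, (a + b) x = a x + b x := fun _ => rfl
      simp only [this]
      rw [integral_add (a.integrable μ) (b.integrable μ), integral_add (a.integrable ν)
        (b.integrable ν), ha, hb]
    | smul c a _ ha =>
      have : ∀ x, (c • a) x = c * a x := fun _ => rfl
      simp only [this]
      rw [integral_const_mul, integral_const_mul, ha]

/-! ### Total offspring laws and the composition rule -/

lemma isProbabilityMeasure_totalOffspringLaw {d : ℕ} (κ : Fin d → Measure (Fin d → ℕ))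
    (hκ : ∀ k, IsProbabilityMeasure (κ k)) (z : Fin d → ℕ) :
    IsProbabilityMeasure (totalOffspringLaw κ z) :=
  Measure.isProbabilityMeasure_map (measurable_of_countable _).aemeasurable

/-- The monomial turns the sum over individuals into a product, and their independence factors the
integral. -/
lemma lintegral_totalOffspringLaw {d : ℕ} (κ : Fin d → Measure (Fin d → ℕ))
    (hκ : ∀ k, IsProbabilityMeasure (κ k)) (z : Fin d → ℕ) (w : Fin d → ℝ≥0∞) :
    ∫⁻ u, ∏ t, w t ^ u t ∂totalOffspringLaw κ z = ∏ k, (∫⁻ u, ∏ t, w t ^ u t ∂κ k) ^ z k := by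
  rw [totalOffspringLaw, lintegral_map (measurable_of_countable _) (measurable_of_countable _)]
  have e : ∀ y : (Σ k : Fin d, Fin (z k)) → Fin d → ℕ,
      ∏ t, w t ^ (∑ p, y p) t = ∏ p, ∏ t, w t ^ y p t := by
    intro y
    rw [Finset.prod_comm]
    refine Finset.prod_congr rfl fun t _ => ?_
    rw [Finset.sum_apply, Finset.prod_pow_eq_pow_sum]
  simp only [e]
  have hind := iIndepFun_pi (μ := fun p : (Σ k : Fin d, Fin (z k)) => κ p.1)
    (X := fun _ (u : Fin d → ℕ) => ∏ t, w t ^ u t)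
    fun _ => (measurable_of_countable _).aemeasurable
  rw [lintegral_prod_eq_prod_lintegral_of_indepFun Finset.univ _ hind
    fun _ => measurable_of_countable _]
  have hev : ∀ p : (Σ k : Fin d, Fin (z k)), ∫⁻ y, ∏ t, w t ^ y p t
      ∂Measure.pi (fun p : (Σ k : Fin d, Fin (z k)) => κ p.1) = ∫⁻ u, ∏ t, w t ^ u t ∂κ p.1 :=
    fun p => (measurePreserving_eval (fun p : (Σ k : Fin d, Fin (z k)) => κ p.1) p).lintegral_comp
      (f := fun u => ∏ t, w t ^ u t) (measurable_of_countable _)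
  simp only [hev]
  rw [Fintype.prod_sigma]
  simp

lemma lintegral_coe_totalOffspringLaw {d : ℕ} (κ : Fin d → Measure (Fin d → ℕ))
    (hκ : ∀ k, IsProbabilityMeasure (κ k)) (z : Fin d → ℕ) (l : Fin d) :
    ∫⁻ u, (u l : ℝ≥0∞) ∂totalOffspringLaw κ z = ∑ k, z k * ∫⁻ u, (u l : ℝ≥0∞) ∂κ k := by
  rw [totalOffspringLaw, lintegral_map (measurable_of_countable _) (measurable_of_countable _)]
  simp only [Finset.sum_apply, Nat.cast_sum]
  rw [lintegral_finsetSum _ fun _ _ => measurable_of_countable _]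
  have hev : ∀ p : (Σ k : Fin d, Fin (z k)), ∫⁻ y, (y p l : ℝ≥0∞)
      ∂Measure.pi (fun p : (Σ k : Fin d, Fin (z k)) => κ p.1) = ∫⁻ u, (u l : ℝ≥0∞) ∂κ p.1 :=
    fun p => (measurePreserving_eval (fun p : (Σ k : Fin d, Fin (z k)) => κ p.1) p).lintegral_comp
      (f := fun u => (u l : ℝ≥0∞)) (measurable_of_countable _)
  simp only [hev]
  rw [Fintype.sum_sigma]
  simp

lemma totalOffspringLaw_single {d : ℕ} (κ : Fin d → Measure (Fin d → ℕ))
    (hκ : ∀ k, IsProbabilityMeasure (κ k)) (k : Fin d) :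
    totalOffspringLaw κ (Pi.single k 1) = κ k := by
  have huniq : ∀ p : (Σ k' : Fin d, Fin ((Pi.single k 1 : Fin d → ℕ) k')),
      p = ⟨k, ⟨0, by simp⟩⟩ := by
    rintro ⟨k', i, hi⟩
    by_cases hk : k' = k
    · subst hk
      simp at hi
      subst hi
      rfl
    · rw [Pi.single_eq_of_ne hk] at hi
      omega
  let : Unique (Σ k' : Fin d, Fin ((Pi.single k 1 : Fin d → ℕ) k')) :=
    ⟨⟨⟨k, ⟨0, by simp⟩⟩⟩, huniq⟩
  rw [totalOffspringLaw]
  simp only [Fintype.sum_unique]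
  exact (measurePreserving_eval (fun p : (Σ k' : Fin d, Fin ((Pi.single k 1 : Fin d → ℕ) k')) =>
    κ p.1) default).map_eq

/-- The composition rule for generating functions determines the joint law of a history `Y` and of
the offspring `W` of its component `i₀`. -/
lemma map_prodMk_eq_compProd {S ι : Type*} [MeasurableSpace S] [Fintype ι] [DecidableEq ι] {d : ℕ}
    (μ : Measure S) [IsProbabilityMeasure μ] {Y : S → ι → Fin d → ℕ} (hY : Measurable Y)
    {W : S → Fin d → ℕ} (hW : Measurable W) {κ : Fin d → Measure (Fin d → ℕ)}
    (hκ : ∀ k, IsProbabilityMeasure (κ k)) (i₀ : ι)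
    (h : ∀ (σ : ι → Fin d → ℝ) (τ : Fin d → ℝ), (∀ m t, 0 ≤ σ m t ∧ σ m t ≤ 1) →
      (∀ t, 0 ≤ τ t ∧ τ t ≤ 1) →
      ∫⁻ x, (∏ m, ∏ t, ENNReal.ofReal (σ m t) ^ Y x m t) * ∏ t, ENNReal.ofReal (τ t) ^ W x t ∂μ =
        ∫⁻ x, (∏ m, ∏ t, ENNReal.ofReal (σ m t) ^ Y x m t) *
          ∏ k, (∫⁻ u, ∏ t, ENNReal.ofReal (τ t) ^ u t ∂κ k) ^ Y x i₀ k ∂μ) :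
    μ.map (fun x => (Y x, W x)) = (μ.map Y) ⊗ₘ
      (Kernel.ofFunOfCountable fun a : ι → Fin d → ℕ => totalOffspringLaw κ (a i₀)) := by
  let A := ι → Fin d → ℕ
  let K : Kernel A (Fin d → ℕ) := Kernel.ofFunOfCountable fun a => totalOffspringLaw κ (a i₀)
  change μ.map (fun x => (Y x, W x)) = (μ.map Y) ⊗ₘ K
  have : IsMarkovKernel K := ⟨fun a => isProbabilityMeasure_totalOffspringLaw κ hκ (a i₀)⟩
  have : IsProbabilityMeasure (μ.map Y) := Measure.isProbabilityMeasure_map hY.aemeasurable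
  have hYW : Measurable fun x => (Y x, W x) := hY.prodMk hW
  have : IsProbabilityMeasure (μ.map fun x => (Y x, W x)) :=
    Measure.isProbabilityMeasure_map hYW.aemeasurable
  let f : (ι → Fin d → ℝ) → (Fin d → ℝ) → A × (Fin d → ℕ) → ℝ := fun σ τ p =>
    (∏ m, ∏ t, σ m t ^ p.1 m t) * ∏ t, τ t ^ p.2 t
  let M : Submonoid (A × (Fin d → ℕ) → ℝ) :=
    { carrier := {g | ∃ σ τ, (∀ m t, 0 ≤ σ m t ∧ σ m t ≤ 1) ∧ (∀ t, 0 ≤ τ t ∧ τ t ≤ 1) ∧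
        g = f σ τ}
      mul_mem' := by
        rintro _ _ ⟨σ, τ, h1, h2, rfl⟩ ⟨σ', τ', h1', h2', rfl⟩
        refine ⟨σ * σ', τ * τ', fun m t => ⟨mul_nonneg (h1 m t).1 (h1' m t).1,
          mul_le_one₀ (h1 m t).2 (h1' m t).1 (h1' m t).2⟩, fun t => ⟨mul_nonneg (h2 t).1 (h2' t).1,
          mul_le_one₀ (h2 t).2 (h2' t).1 (h2' t).2⟩, ?_⟩
        funext p
        simp only [f, Pi.mul_apply, mul_pow, Finset.prod_mul_distrib]
        ring
      one_mem' := ⟨1, 1, by simp, by simp, by funext p; simp [f]⟩ }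
  have hof : ∀ (σ : ι → Fin d → ℝ) (τ : Fin d → ℝ), (∀ m t, 0 ≤ σ m t ∧ σ m t ≤ 1) →
      (∀ t, 0 ≤ τ t ∧ τ t ≤ 1) → ∀ p, ENNReal.ofReal (f σ τ p) =
        (∏ m, ∏ t, ENNReal.ofReal (σ m t) ^ p.1 m t) * ∏ t, ENNReal.ofReal (τ t) ^ p.2 t := by
    intro σ τ h1 h2 p
    have n1 : ∀ m t, 0 ≤ σ m t ^ p.1 m t := fun m t => pow_nonneg (h1 m t).1 _
    have n2 : ∀ m, 0 ≤ ∏ t, σ m t ^ p.1 m t := fun m => Finset.prod_nonneg fun t _ => n1 m t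
    rw [ENNReal.ofReal_mul (Finset.prod_nonneg fun m _ => n2 m),
      ENNReal.ofReal_prod_of_nonneg (fun m _ => n2 m),
      ENNReal.ofReal_prod_of_nonneg (fun t _ => pow_nonneg (h2 t).1 _)]
    simp only [ENNReal.ofReal_pow (h2 _).1]
    congr 1
    refine Finset.prod_congr rfl fun m _ => ?_
    rw [ENNReal.ofReal_prod_of_nonneg fun t _ => n1 m t]
    simp only [ENNReal.ofReal_pow (h1 _ _).1]
  refine measure_ext_of_submonoid M ?_ ?_ ?_
  · rintro _ ⟨σ, τ, h1, h2, rfl⟩ p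
    have n2 : ∀ m, 0 ≤ ∏ t, σ m t ^ p.1 m t := fun m =>
      Finset.prod_nonneg fun t _ => pow_nonneg (h1 m t).1 _
    have n3 : 0 ≤ ∏ t, τ t ^ p.2 t := Finset.prod_nonneg fun t _ => pow_nonneg (h2 t).1 _
    refine ⟨mul_nonneg (Finset.prod_nonneg fun m _ => n2 m) n3, mul_le_one₀ ?_ n3 ?_⟩
    · exact Finset.prod_le_one (fun m _ => n2 m) fun m _ =>
        Finset.prod_le_one (fun t _ => pow_nonneg (h1 m t).1 _) fun t _ =>
          pow_le_one₀ (h1 m t).1 (h1 m t).2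
    · exact Finset.prod_le_one (fun t _ => pow_nonneg (h2 t).1 _) fun t _ =>
        pow_le_one₀ (h2 t).1 (h2 t).2
  · rintro ⟨a, b⟩ ⟨a', b'⟩ hne
    by_cases hab : a = a'
    · have hb : b ≠ b' := fun hb => hne (by rw [hab, hb])
      obtain ⟨t, ht⟩ := Function.ne_iff.1 hb
      -- Setting one argument to `1 / 2` and the others to `1` reads off a single exponent, since
      -- powers of `1 / 2` are injective.
      refine ⟨_, ⟨1, Function.update 1 t (1 / 2), by simp, fun t' => ?_, rfl⟩, ?_⟩
      · rw [Function.update_apply]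
        split_ifs <;> norm_num
      · have e : ∀ c : Fin d → ℕ, ∏ t', (Function.update 1 t (1 / 2) : Fin d → ℝ) t' ^ c t'
            = (1 / 2) ^ c t := by
          intro c
          rw [Finset.prod_eq_single t (fun t' _ ht' => by simp [ht']) (by simp)]
          simp
        simp only [f, e, Pi.one_apply, one_pow, Finset.prod_const_one, one_mul]
        exact fun h => ht (pow_right_injective₀ (by norm_num) (by norm_num) h)
    · obtain ⟨m, hm⟩ := Function.ne_iff.1 hab
      obtain ⟨t, ht⟩ := Function.ne_iff.1 hm
      refine ⟨_, ⟨Function.update 1 m (Function.update 1 t (1 / 2)), 1, fun m' t' => ?_, by simp,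
        rfl⟩, ?_⟩
      · rw [Function.update_apply]
        split_ifs
        · rw [Function.update_apply]
          split_ifs <;> norm_num
        · simp
      · have e : ∀ c : A, ∏ m', ∏ t', (Function.update 1 m (Function.update 1 t (1 / 2)) :
            ι → Fin d → ℝ) m' t' ^ c m' t' = (1 / 2) ^ c m t := by
          intro c
          rw [Finset.prod_eq_single m (fun m' _ hm' => by simp [hm']) (by simp),
            Finset.prod_eq_single t (fun t' _ ht' => by simp [ht']) (by simp)]
          simp
        simp only [f, e, Pi.one_apply, one_pow, Finset.prod_const_one, mul_one]
        exact fun h => ht (pow_right_injective₀ (by norm_num) (by norm_num) h)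
  · rintro _ ⟨σ, τ, h1, h2, rfl⟩
    simp only [hof σ τ h1 h2]
    rw [lintegral_map (measurable_of_countable _) hYW,
      Measure.lintegral_compProd (measurable_of_countable _),
      lintegral_map (measurable_of_countable _) hY]
    have e : ∀ a : A, ∫⁻ b, (∏ m, ∏ t, ENNReal.ofReal (σ m t) ^ a m t) *
        ∏ t, ENNReal.ofReal (τ t) ^ b t ∂K a = (∏ m, ∏ t, ENNReal.ofReal (σ m t) ^ a m t) *
        ∏ k, (∫⁻ u, ∏ t, ENNReal.ofReal (τ t) ^ u t ∂κ k) ^ a i₀ k := by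
      intro a
      rw [lintegral_const_mul _ (measurable_of_countable _)]
      congr 1
      exact lintegral_totalOffspringLaw κ hκ _ _
    simp only [e]
    exact h σ τ h1 h2

/-- The composition rule for the generating functions of the generations `Z` with offspring laws
`κ`. -/
def HasBranchingGen {S : Type*} [MeasurableSpace S] {d : ℕ} (μ : Measure S)
    (Z : ℕ → S → Fin d → ℕ) (κ : ℕ → Fin d → Measure (Fin d → ℕ)) : Prop :=
  ∀ (n : ℕ) (σ : ℕ → Fin d → ℝ) (τ : Fin d → ℝ), (∀ m t, 0 ≤ σ m t ∧ σ m t ≤ 1) →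
    (∀ t, 0 ≤ τ t ∧ τ t ≤ 1) →
    ∫⁻ x, (∏ m ∈ Finset.range (n + 1), ∏ t, ENNReal.ofReal (σ m t) ^ Z m x t) *
        ∏ t, ENNReal.ofReal (τ t) ^ Z (n + 1) x t ∂μ =
      ∫⁻ x, (∏ m ∈ Finset.range (n + 1), ∏ t, ENNReal.ofReal (σ m t) ^ Z m x t) *
        ∏ k, (∫⁻ u, ∏ t, ENNReal.ofReal (τ t) ^ u t ∂κ n k) ^ Z n x k ∂μ

namespace HasBranchingGen

variable {S : Type*} [MeasurableSpace S] {d : ℕ} {μ : Measure S} [IsProbabilityMeasure μ]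
  {Z : ℕ → S → Fin d → ℕ} {κ : ℕ → Fin d → Measure (Fin d → ℕ)}

/-- The joint law of the generations up to `n` and of generation `n + 1`. -/
lemma map_eq_compProd (h : HasBranchingGen μ Z κ) (hZ : ∀ n, Measurable (Z n))
    (hκ : ∀ n k, IsProbabilityMeasure (κ n k)) (n : ℕ) :
    μ.map (fun x => (fun m : Fin (n + 1) => Z m x, Z (n + 1) x)) =
      (μ.map fun x (m : Fin (n + 1)) => Z m x) ⊗ₘ (Kernel.ofFunOfCountable
        fun a : Fin (n + 1) → Fin d → ℕ => totalOffspringLaw (κ n) (a (Fin.last n))) := by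
  refine map_prodMk_eq_compProd μ (Y := fun x (m : Fin (n + 1)) => Z m x)
    (measurable_pi_lambda _ fun m => hZ m) (hZ _) (hκ n) (Fin.last n) fun σ τ h1 h2 => ?_
  have h3 := h n (fun m => if hm : m < n + 1 then σ ⟨m, hm⟩ else 0) τ (fun m t => by
    split_ifs
    · exact h1 _ t
    · simp) h2
  simpa only [Finset.prod_range, Fin.is_lt, dite_true, Fin.eta, Fin.val_last] using h3

/-- Only the last generation of the histories in `B` is fixed. A single history gives the branching
property; all histories ending in a unit vector give the offspring law of one particle. -/
lemma measure_inter (h : HasBranchingGen μ Z κ) (hZ : ∀ n, Measurable (Z n))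
    (hκ : ∀ n k, IsProbabilityMeasure (κ n k)) (n : ℕ) (B : Set (Fin (n + 1) → Fin d → ℕ))
    (z u : Fin d → ℕ) (hB : ∀ a ∈ B, a (Fin.last n) = z) :
    μ ({x | (fun m : Fin (n + 1) => Z m x) ∈ B} ∩ {x | Z (n + 1) x = u}) =
      μ {x | (fun m : Fin (n + 1) => Z m x) ∈ B} * totalOffspringLaw (κ n) z {u} := by
  have hF : Measurable fun x (m : Fin (n + 1)) => Z m x := measurable_pi_lambda _ fun m => hZ m
  have : IsProbabilityMeasure (μ.map fun x (m : Fin (n + 1)) => Z m x) :=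
    Measure.isProbabilityMeasure_map hF.aemeasurable
  have : IsMarkovKernel (Kernel.ofFunOfCountable
      fun a : Fin (n + 1) → Fin d → ℕ => totalOffspringLaw (κ n) (a (Fin.last n))) :=
    ⟨fun a => isProbabilityMeasure_totalOffspringLaw (κ n) (hκ n) (a (Fin.last n))⟩
  have hBm : MeasurableSet B := MeasurableSet.of_discrete
  have h4 := congrArg (fun ρ => ρ (B ×ˢ {u})) (h.map_eq_compProd hZ hκ n)
  rw [Measure.map_apply (hF.prodMk (hZ _)) (hBm.prod (measurableSet_singleton _)),
    Measure.compProd_apply_prod hBm (measurableSet_singleton _)] at h4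
  refine Eq.trans ?_ (h4.trans ?_)
  · rfl
  · rw [setLIntegral_congr_fun (g := fun _ => totalOffspringLaw (κ n) z {u}) hBm
      (fun a ha => by
        change totalOffspringLaw (κ n) (a (Fin.last n)) {u} = _
        rw [hB a ha]), setLIntegral_const, Measure.map_apply hF hBm, mul_comm]
    rfl

lemma isMultitypeBranching (h : HasBranchingGen μ Z κ) (hZ : ∀ n, Measurable (Z n))
    (hκ : ∀ n k, IsProbabilityMeasure (κ n k)) : IsMultitypeBranching μ Z κ := by
  refine ⟨fun n => (hZ n).aemeasurable, hκ, fun n z => ?_⟩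
  have h1 := h.measure_inter hZ hκ n {fun m : Fin (n + 1) => z m} (z n) (z (n + 1)) (by
    rintro a rfl
    simp)
  have e1 : {s | ∀ m ≤ n, Z m s = z m} =
      {x | (fun m : Fin (n + 1) => Z m x) ∈ ({fun m : Fin (n + 1) => z m} : Set _)} := by
    ext s
    simp only [Set.mem_ofPred_eq, Set.mem_singleton_iff]
    exact ⟨fun hs => funext fun m => hs m (Nat.lt_succ_iff.1 m.2),
      fun hs m hm => congrFun hs ⟨m, Nat.lt_succ_iff.2 hm⟩⟩
  have e2 : {s | ∀ m ≤ n + 1, Z m s = z m} =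
      {s | ∀ m ≤ n, Z m s = z m} ∩ {s | Z (n + 1) s = z (n + 1)} := by
    ext s
    simp only [Set.mem_ofPred_eq, Set.mem_inter_iff]
    refine ⟨fun hs => ⟨fun m hm => hs m (by omega), hs _ le_rfl⟩, fun hs m hm => ?_⟩
    rcases Nat.lt_or_ge n m with hlt | hle
    · obtain rfl : m = n + 1 := by omega
      exact hs.2
    · exact hs.1 m hle
  rw [e2, e1, h1]

/-- Conditionally on a single individual of type `k`, the next generation has law `κ n k`. -/
lemma measure_single_inter (h : HasBranchingGen μ Z κ) (hZ : ∀ n, Measurable (Z n))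
    (hκ : ∀ n k, IsProbabilityMeasure (κ n k)) (n : ℕ) (k : Fin d) (u : Fin d → ℕ) :
    μ ({x | Z n x = Pi.single k 1} ∩ {x | Z (n + 1) x = u}) =
      μ {x | Z n x = Pi.single k 1} * κ n k {u} := by
  have h1 := h.measure_inter hZ hκ n {a | a (Fin.last n) = Pi.single k 1} _ u fun a ha => ha
  rw [totalOffspringLaw_single (κ n) (hκ n)] at h1
  exact h1

/-- The recursion for the mean generation sizes. -/
lemma lintegral_succ (h : HasBranchingGen μ Z κ) (hZ : ∀ n, Measurable (Z n))
    (hκ : ∀ n k, IsProbabilityMeasure (κ n k)) (n : ℕ) (l : Fin d) :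
    ∫⁻ x, (Z (n + 1) x l : ℝ≥0∞) ∂μ =
      ∑ k, (∫⁻ x, (Z n x k : ℝ≥0∞) ∂μ) * ∫⁻ u, (u l : ℝ≥0∞) ∂κ n k := by
  have hF : Measurable fun x (m : Fin (n + 1)) => Z m x := measurable_pi_lambda _ fun m => hZ m
  have : IsProbabilityMeasure (μ.map fun x (m : Fin (n + 1)) => Z m x) :=
    Measure.isProbabilityMeasure_map hF.aemeasurable
  have : IsMarkovKernel (Kernel.ofFunOfCountable
      fun a : Fin (n + 1) → Fin d → ℕ => totalOffspringLaw (κ n) (a (Fin.last n))) :=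
    ⟨fun a => isProbabilityMeasure_totalOffspringLaw (κ n) (hκ n) (a (Fin.last n))⟩
  have h4 := congrArg (fun ρ => ∫⁻ p, (p.2 l : ℝ≥0∞) ∂ρ) (h.map_eq_compProd hZ hκ n)
  rw [lintegral_map (measurable_of_countable _) (hF.prodMk (hZ _)),
    Measure.lintegral_compProd (measurable_of_countable _),
    lintegral_map (measurable_of_countable _) hF] at h4
  have e : ∀ z : Fin d → ℕ, ∫⁻ u, (u l : ℝ≥0∞) ∂totalOffspringLaw (κ n) z =
    ∑ k, z k * ∫⁻ u, (u l : ℝ≥0∞) ∂κ n k :=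
      fun z => lintegral_coe_totalOffspringLaw (κ n) (hκ n) z l
  refine h4.trans ?_
  change ∫⁻ x, ∫⁻ u, (u l : ℝ≥0∞) ∂totalOffspringLaw (κ n) (Z n x) ∂μ = _
  simp only [e]
  have hm : ∀ k, Measurable fun x => (Z n x k : ℝ≥0∞) := fun k =>
    (measurable_of_countable fun u : Fin d → ℕ => (u k : ℝ≥0∞)).comp (hZ n)
  rw [lintegral_finsetSum _ fun k _ => (hm k).mul_const _]
  simp only [lintegral_mul_const _ (hm _)]

end HasBranchingGen

/-! ### The offspring laws -/

/-- The law of `(A, B, c)` where `A` and `B` count the outcomes of probabilities `a` and `b` in a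
sequence of trials stopped at the first outcome of the remaining probability `1 - a - b`. -/
noncomputable def geomOffspring (a b : ℝ) (c : ℕ) : Measure (Fin 3 → ℕ) :=
  Measure.sum fun n : ℕ => ∑ m ∈ Finset.range (n + 1),
    ENNReal.ofReal ((1 - a - b) * (a ^ m * b ^ (n - m) * n.choose m)) •
      Measure.dirac ![m, n - m, c]

lemma lintegral_geomOffspring (a b : ℝ) (c : ℕ) (f : (Fin 3 → ℕ) → ℝ≥0∞) :
    ∫⁻ u, f u ∂geomOffspring a b c = ∑' n : ℕ, ∑ m ∈ Finset.range (n + 1),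
      ENNReal.ofReal ((1 - a - b) * (a ^ m * b ^ (n - m) * n.choose m)) * f ![m, n - m, c] := by
  rw [geomOffspring, lintegral_sum_measure]
  refine tsum_congr fun n => ?_
  rw [lintegral_finsetSum_measure]
  refine Finset.sum_congr rfl fun m _ => ?_
  rw [lintegral_smul_measure, lintegral_dirac' _ (measurable_of_countable f), smul_eq_mul]

lemma tsum_ofReal_of_hasSum {f : ℕ → ℝ} {r : ℝ} (hf : ∀ n, 0 ≤ f n) (h : HasSum f r) :
    ∑' n, ENNReal.ofReal (f n) = ENNReal.ofReal r := by
  rw [← ENNReal.ofReal_tsum_of_nonneg hf h.summable, h.tsum_eq]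

/-- For a fixed number `n` of trials the binomial theorem sums over `m`; the sum over `n` is
geometric. -/
lemma lintegral_prod_pow_geomOffspring {a b : ℝ} (ha : 0 ≤ a) (hb : 0 ≤ b) (hab : a + b < 1)
    (c : ℕ) {v : Fin 3 → ℝ} (hv : ∀ t, 0 ≤ v t ∧ v t ≤ 1) :
    ∫⁻ u, ∏ t, ENNReal.ofReal (v t) ^ u t ∂geomOffspring a b c =
      ENNReal.ofReal ((1 - a - b) / (1 - a * v 0 - b * v 1) * v 2 ^ c) := by
  rw [lintegral_geomOffspring]
  have h0 : 0 ≤ a * v 0 + b * v 1 :=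
    add_nonneg (mul_nonneg ha (hv 0).1) (mul_nonneg hb (hv 1).1)
  have h1 : a * v 0 + b * v 1 < 1 := by
    linarith [mul_le_of_le_one_right ha (hv 0).2, mul_le_of_le_one_right hb (hv 1).2]
  have hK : 0 ≤ 1 - a - b := by linarith
  have hc : 0 ≤ v 2 ^ c := pow_nonneg (hv 2).1 c
  have e : ∀ n : ℕ, ∑ m ∈ Finset.range (n + 1),
      ENNReal.ofReal ((1 - a - b) * (a ^ m * b ^ (n - m) * n.choose m)) *
        ∏ t, ENNReal.ofReal (v t) ^ (![m, n - m, c] : Fin 3 → ℕ) t =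
      ENNReal.ofReal ((1 - a - b) * v 2 ^ c * (a * v 0 + b * v 1) ^ n) := by
    intro n
    rw [add_pow, Finset.mul_sum, ENNReal.ofReal_sum_of_nonneg]
    · refine Finset.sum_congr rfl fun m _ => ?_
      rw [Fin.prod_univ_three]
      simp only [Matrix.cons_val_zero, Matrix.cons_val_one, Matrix.cons_val]
      rw [← ENNReal.ofReal_pow (hv 0).1, ← ENNReal.ofReal_pow (hv 1).1,
        ← ENNReal.ofReal_pow (hv 2).1, ← ENNReal.ofReal_mul (pow_nonneg (hv 0).1 _),
        ← ENNReal.ofReal_mul (mul_nonneg (pow_nonneg (hv 0).1 _) (pow_nonneg (hv 1).1 _)),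
        ← ENNReal.ofReal_mul (by positivity)]
      congr 1
      ring
    · intro m _
      have := (hv 0).1
      have := (hv 1).1
      positivity
  simp only [e]
  rw [tsum_ofReal_of_hasSum (fun n => by positivity)
    ((hasSum_geometric_of_lt_one h0 h1).mul_left _)]
  congr 1
  rw [← div_eq_mul_inv, ← sub_sub]
  ring

lemma isProbabilityMeasure_geomOffspring {a b : ℝ} (ha : 0 ≤ a) (hb : 0 ≤ b) (hab : a + b < 1)
    (c : ℕ) : IsProbabilityMeasure (geomOffspring a b c) := by
  have h := lintegral_prod_pow_geomOffspring ha hb hab c (v := fun _ => 1) (by simp)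
  have h0 : 1 - a - b ≠ 0 := by linarith
  constructor
  simpa [div_self h0] using h

lemma geomOffspring_singleton_pos {a b : ℝ} (ha : 0 < a) (hb : 0 < b) (hab : a + b < 1)
    (m l c : ℕ) : 0 < geomOffspring a b c {![m, l, c]} := by
  rw [← lintegral_indicator_one (measurableSet_singleton _), lintegral_geomOffspring]
  have hK : 0 < 1 - a - b := by linarith
  refine lt_of_lt_of_le ?_ (ENNReal.le_tsum (m + l))
  refine lt_of_lt_of_le ?_ (Finset.single_le_sum (fun _ _ => zero_le)
    (Finset.mem_range.2 (by omega : m < m + l + 1)))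
  rw [Nat.add_sub_cancel_left, Set.indicator_of_mem (Set.mem_singleton _), Pi.one_apply, mul_one,
    ENNReal.ofReal_pos]
  have : 0 < ((m + l).choose m : ℝ) := by exact_mod_cast Nat.choose_pos (by omega)
  positivity

lemma sum_choose_mul_index (a b : ℝ) (n : ℕ) :
    ∑ m ∈ Finset.range (n + 1), a ^ m * b ^ (n - m) * n.choose m * m =
      n * a * (a + b) ^ (n - 1) := by
  cases n with
  | zero => simp
  | succ n =>
    rw [Finset.sum_range_succ', Nat.add_sub_cancel, add_pow, Finset.mul_sum]
    simp only [Nat.cast_zero, mul_zero, add_zero]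
    refine Finset.sum_congr rfl fun m _ => ?_
    have h : ((n : ℝ) + 1) * n.choose m = (n + 1).choose (m + 1) * (m + 1) := by
      exact_mod_cast Nat.add_one_mul_choose_eq n m
    rw [Nat.succ_sub_succ]
    push_cast
    linear_combination (-(a ^ (m + 1) * b ^ (n - m))) * h

lemma sum_choose_mul_coindex (a b : ℝ) (n : ℕ) :
    ∑ m ∈ Finset.range (n + 1), a ^ m * b ^ (n - m) * n.choose m * ((n - m : ℕ) : ℝ) =
      n * b * (a + b) ^ (n - 1) := by
  rw [add_comm a b, ← sum_choose_mul_index b a n, ← Finset.sum_range_reflect]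
  refine Finset.sum_congr rfl fun m hm => ?_
  have hm : m ≤ n := by rw [Finset.mem_range] at hm; omega
  rw [show n + 1 - 1 - m = n - m by omega, Nat.choose_symm hm, Nat.sub_sub_self hm]
  ring

lemma hasSum_mean {a r : ℝ} (hr : 0 < r) (hr1 : r < 1) :
    HasSum (fun n : ℕ => (1 - r) * (n * a * r ^ (n - 1))) (a / (1 - r)) := by
  have h := (hasSum_coe_mul_geometric_of_norm_lt_one (r := r)
    (by rwa [Real.norm_of_nonneg hr.le])).mul_left ((1 - r) * (a / r))
  have h1 : 1 - r ≠ 0 := by linarith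
  have e1 : (fun n : ℕ => (1 - r) * (n * a * r ^ (n - 1))) =
      fun n : ℕ => (1 - r) * (a / r) * (n * r ^ n) := by
    funext n
    cases n with
    | zero => simp
    | succ n =>
      rw [Nat.add_sub_cancel, pow_succ]
      field_simp
  have e2 : a / (1 - r) = (1 - r) * (a / r) * (r / (1 - r) ^ 2) := by field_simp
  rw [e1, e2]
  exact h

lemma lintegral_geomOffspring_zero {a b : ℝ} (ha : 0 < a) (hb : 0 < b) (hab : a + b < 1)
    (c : ℕ) : ∫⁻ u, (u 0 : ℝ≥0∞) ∂geomOffspring a b c = ENNReal.ofReal (a / (1 - a - b)) := by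
  have hK : 0 < 1 - (a + b) := by linarith
  rw [lintegral_geomOffspring, sub_sub]
  rw [← tsum_ofReal_of_hasSum (fun n => by positivity) (hasSum_mean (a := a) (add_pos ha hb) hab)]
  refine tsum_congr fun n => ?_
  rw [← sum_choose_mul_index, Finset.mul_sum, ENNReal.ofReal_sum_of_nonneg fun m _ => by positivity]
  refine Finset.sum_congr rfl fun m _ => ?_
  simp only [Matrix.cons_val_zero]
  rw [← ENNReal.ofReal_natCast m, ← ENNReal.ofReal_mul (by positivity), mul_assoc]

lemma lintegral_geomOffspring_one {a b : ℝ} (ha : 0 < a) (hb : 0 < b) (hab : a + b < 1)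
    (c : ℕ) : ∫⁻ u, (u 1 : ℝ≥0∞) ∂geomOffspring a b c = ENNReal.ofReal (b / (1 - a - b)) := by
  have hK : 0 < 1 - (a + b) := by linarith
  rw [lintegral_geomOffspring, sub_sub]
  rw [← tsum_ofReal_of_hasSum (fun n => by positivity) (hasSum_mean (a := b) (add_pos ha hb) hab)]
  refine tsum_congr fun n => ?_
  rw [← sum_choose_mul_coindex, Finset.mul_sum,
    ENNReal.ofReal_sum_of_nonneg fun m _ => by positivity]
  refine Finset.sum_congr rfl fun m _ => ?_
  simp only [Matrix.cons_val_one, Matrix.cons_val_zero]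
  rw [← ENNReal.ofReal_natCast (n - m), ← ENNReal.ofReal_mul (by positivity), mul_assoc]

lemma lintegral_geomOffspring_two {a b : ℝ} (ha : 0 ≤ a) (hb : 0 ≤ b) (hab : a + b < 1)
    (c : ℕ) : ∫⁻ u, (u 2 : ℝ≥0∞) ∂geomOffspring a b c = c := by
  have := isProbabilityMeasure_geomOffspring ha hb hab c
  have h : ∫⁻ _, (c : ℝ≥0∞) ∂geomOffspring a b c = c := by simp
  rw [← h, lintegral_geomOffspring, lintegral_geomOffspring]
  simp only [Matrix.cons_val]

/-- The offspring law in generation `j` of an individual of type `k`. -/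
noncomputable def offspring (ω : Env) (j : ℤ) (k : Fin 3) : Measure (Fin 3 → ℕ) :=
  geomOffspring (α ω j) (β ω j) (![0, 1, 0] k)

namespace IsPositiveEnv

variable {ω : Env}

lemma α_add_β_lt_one (hω : IsPositiveEnv ω) (j : ℤ) : α ω j + β ω j < 1 := by
  linarith [hω.one_sub_α_sub_β_pos j]

lemma isProbabilityMeasure_offspring (hω : IsPositiveEnv ω) (j : ℤ) (k : Fin 3) :
    IsProbabilityMeasure (offspring ω j k) :=
  isProbabilityMeasure_geomOffspring (hω.α_pos j).le (hω.β_pos j).le (hω.α_add_β_lt_one j) _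

lemma lintegral_prod_pow_offspring (hω : IsPositiveEnv ω) (j : ℤ) {v : Fin 3 → ℝ}
    (hv : ∀ t, 0 ≤ v t ∧ v t ≤ 1) (k : Fin 3) :
    ∫⁻ u, ∏ t, ENNReal.ofReal (v t) ^ u t ∂offspring ω j k =
      ENNReal.ofReal (offspringGen ω j v k) := by
  rw [offspring, lintegral_prod_pow_geomOffspring (hω.α_pos j).le (hω.β_pos j).le
    (hω.α_add_β_lt_one j) _ hv, offspringGen]
  fin_cases k <;> simp

lemma N_nonneg (hω : IsPositiveEnv ω) (j : ℤ) (k l : Fin 3) : 0 ≤ N ω j k l := by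
  have h1 := (div_pos (hω.α_pos j) (hω.one_sub_α_sub_β_pos j)).le
  have h2 := (div_pos (hω.β_pos j) (hω.one_sub_α_sub_β_pos j)).le
  fin_cases k <;> fin_cases l <;> simp [N, h1, h2]

lemma lintegral_offspring (hω : IsPositiveEnv ω) (j : ℤ) (k l : Fin 3) :
    ∫⁻ u, (u l : ℝ≥0∞) ∂offspring ω j k = ENNReal.ofReal (N ω j k l) := by
  have h0 := lintegral_geomOffspring_zero (hω.α_pos j) (hω.β_pos j) (hω.α_add_β_lt_one j)
  have h1 := lintegral_geomOffspring_one (hω.α_pos j) (hω.β_pos j) (hω.α_add_β_lt_one j)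
  have h2 := lintegral_geomOffspring_two (hω.α_pos j).le (hω.β_pos j).le (hω.α_add_β_lt_one j)
  rw [offspring]
  fin_cases l
  · refine (h0 _).trans ?_
    fin_cases k <;> rfl
  · refine (h1 _).trans ?_
    fin_cases k <;> rfl
  · refine (h2 _).trans ?_
    fin_cases k <;> simp [N]

/-! ### The branching process -/

lemma hasBranchingGen (hω : IsPositiveEnv ω)
    (hexit : ∀ᵐ x ∂quenched ω 0, ∃ n, 0 < x n) :
    HasBranchingGen (quenched ω 0) (fun n x => jumpVec x (1 - (n : ℤ)))
      (fun n => offspring ω (-(n : ℤ))) := by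
  intro n σ τ hσ hτ
  -- Level `-n` carries `τ`, level `1 - m` carries `σ m` for `m ≤ n`, and all others carry `1`.
  -- Absorbing the lowest level `-n` multiplies `σ n` by the offspring generating function at `τ`.
  let s : ℤ → Fin 3 → ℝ := fun i =>
    if i = -(n : ℤ) then τ else if -(n : ℤ) < i ∧ i ≤ 1 then σ (1 - i).toNat else 1
  have hs : IsUnitArg s := by
    intro i t
    dsimp only [s]
    split_ifs
    · exact hτ t
    · exact hσ _ t
    · simp
  have s0 : s (-(n : ℤ)) = τ := if_pos rfl
  have s1 : ∀ m ≤ n, s (1 - (m : ℤ)) = σ m := by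
    intro m hm
    dsimp only [s]
    rw [if_neg (by omega), if_pos (by omega)]
    congr
    omega
  have s2 : ∀ i, i < -(n : ℤ) ∨ 1 < i → s i = 1 := by
    intro i hi
    dsimp only [s]
    rw [if_neg (by omega), if_neg (by omega)]
  have a1 : absorb ω (-(n : ℤ)) s (1 - (n : ℤ)) = σ n * offspringGen ω (-(n : ℤ)) τ := by
    rw [absorb, if_neg (by omega), if_pos (by omega), s0, s1 n le_rfl]
  have a2 : ∀ m < n, absorb ω (-(n : ℤ)) s (1 - (m : ℤ)) = σ m := by
    intro m hm
    rw [absorb, if_neg (by omega), if_neg (by omega), s1 m hm.le]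
  have a3 : ∀ i, (∀ m ≤ n, i ≠ 1 - (m : ℤ)) → absorb ω (-(n : ℤ)) s i = 1 := by
    intro i hi
    have h1 : ¬ (-(n : ℤ) < i ∧ i ≤ 1) := fun h => hi (1 - i).toNat (by omega) (by omega)
    rw [absorb]
    split_ifs with h2 h3
    · rfl
    · exact absurd (by omega) (hi n le_rfl)
    · exact s2 i (by omega)
  have hL := lintegral_prod_pow_jumpVec hexit hs (n := n + 1) fun i hi => by
    have h1 : ¬ (-(n : ℤ) ≤ i ∧ i ≤ 1) := fun h => hi (1 - i).toNat (by omega) (by omega)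
    exact s2 i (by omega)
  have hR := lintegral_prod_pow_jumpVec hexit (hω.isUnitArg_absorb hs (-(n : ℤ))) (n := n) a3
  have hj := hω.exitGen_absorb hs (j := -(n : ℤ)) (fun i hi => s2 i (Or.inl hi)) n
  rw [neg_add_cancel] at hj
  rw [hj.1, hj.2, ← hL] at hR
  have e1 : (1 - ((n + 1 : ℕ) : ℤ)) = -(n : ℤ) := by push_cast; ring
  simp only [hω.lintegral_prod_pow_offspring _ hτ]
  refine Eq.trans ?_ (hR.symm.trans ?_)
  · refine lintegral_congr fun x => ?_
    rw [Finset.prod_range_succ _ (n + 1), e1, s0]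
    congr 1
    refine Finset.prod_congr rfl fun m hm => ?_
    rw [s1 m (by rw [Finset.mem_range] at hm; omega)]
  · refine lintegral_congr fun x => ?_
    rw [Finset.prod_range_succ, Finset.prod_range_succ, a1, mul_assoc, ← Finset.prod_mul_distrib]
    congr 1
    · refine Finset.prod_congr rfl fun m hm => ?_
      rw [a2 m (Finset.mem_range.1 hm)]
    · refine Finset.prod_congr rfl fun t _ => ?_
      rw [Pi.mul_apply, ENNReal.ofReal_mul (hσ _ _).1, mul_pow]

end IsPositiveEnv

lemma IsWalkPath.jumpVec_one {x : ℕ → ℤ} (hx : IsWalkPath x) :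
    ∃ k : Fin 3, jumpVec x 1 = Pi.single k 1 := by
  have hpos := hx.pos_firstPos
  obtain ⟨T, hT⟩ : ∃ T, firstPos x = T + 1 := by
    refine Nat.exists_eq_succ_of_ne_zero fun h => ?_
    rw [h, hx.zero] at hpos
    exact lt_irrefl _ hpos
  have hle : ∀ m, m ≤ T → x m ≤ 0 := fun m hm => hx.nonpos_of_lt (by omega)
  have hcount : ∀ s t : ℤ, 0 < t →
      jumpCount x s t = if x T = s ∧ x (T + 1) = t then 1 else 0 := by
    intro s t ht
    rw [jumpCount, hT, Finset.sum_range_succ, Finset.sum_eq_zero, zero_add]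
    intro j hj
    rw [Finset.mem_range] at hj
    have := hle (j + 1) hj
    rw [if_neg (by omega)]
  rw [hT] at hpos
  have h0 := hle T le_rfl
  have hv : jumpVec x 1 = ![jumpCount x 0 1, jumpCount x (-1) 1, jumpCount x 0 2] := by
    funext t
    fin_cases t <;> rfl
  rw [hv, hcount _ _ one_pos, hcount _ _ one_pos, hcount _ _ two_pos]
  rcases hx.step T with h | h | h
  · omega
  · refine ⟨0, ?_⟩
    rw [if_pos (by omega), if_neg (by omega), if_neg (by omega)]
    funext t
    fin_cases t <;> rfl
  · rcases lt_or_ge (x T) 0 with h1 | h1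
    · refine ⟨1, ?_⟩
      rw [if_neg (by omega), if_pos (by omega), if_neg (by omega)]
      funext t
      fin_cases t <;> rfl
    · refine ⟨2, ?_⟩
      rw [if_neg (by omega), if_neg (by omega), if_pos (by omega)]
      funext t
      fin_cases t <;> rfl

namespace IsPositiveEnv

variable {ω : Env}

/-- The mean of the immigrant vector `U(1)`, which is almost surely a unit vector. -/
lemma lintegral_jumpVec_one (hω : IsPositiveEnv ω)
    (hexit : ∀ᵐ x ∂quenched ω 0, ∃ n, 0 < x n) (k : Fin 3) :
    ∫⁻ x, (jumpVec x 1 k : ℝ≥0∞) ∂quenched ω 0 =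
      ENNReal.ofReal (1 / (1 - α ω 0 - β ω 0) * ![p₁ ω 0, γ ω 0, p₂ ω 0] k) := by
  -- With the mark `e_k` at level `1`, and `0 ^ 0 = 1`, the monomial of a unit vector `U(1)` equals
  -- its component `U_k(1)`.
  let s : ℤ → Fin 3 → ℝ := fun i => if i = 1 then Pi.single k 1 else 1
  have hs : IsUnitArg s := by
    intro i t
    dsimp only [s]
    split_ifs
    · rw [Pi.single_apply]
      split_ifs <;> simp
    · simp
  have h1 := lintegral_prod_pow_jumpVec hexit hs (n := 0) fun i hi =>
    if_neg (by simpa using hi 0 le_rfl)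
  have h2 := hω.exitGen_lowest hs (j := 0) fun i hi => if_neg (by omega)
  have s0 : s 0 = 1 := if_neg (by omega)
  have s1 : s 1 = Pi.single k 1 := if_pos rfl
  have s2 : s 2 = 1 := if_neg (by omega)
  simp only [h2.1, h2.2, zero_add, s0, s1, s2] at h1
  refine Eq.trans ?_ (h1.trans ?_)
  · refine lintegral_congr_ae ?_
    filter_upwards [ae_isWalkPath hexit] with x hx
    obtain ⟨l, hl⟩ := hx.jumpVec_one
    simp only [Finset.range_one, Finset.prod_singleton, Nat.cast_zero, sub_zero, hl, s1]
    rw [Finset.prod_eq_single l (fun t _ ht => by simp [ht]) (by simp)]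
    simp only [Pi.single_apply, eq_comm]
    split_ifs <;> simp
  · congr 1
    fin_cases k <;> simp <;> ring

/-- Every unit vector occurs in every generation with positive probability. -/
lemma measure_jumpVec_single_pos (hω : IsPositiveEnv ω)
    (hexit : ∀ᵐ x ∂quenched ω 0, ∃ n, 0 < x n) (n : ℕ) (k : Fin 3) :
    0 < quenched ω 0 {x | jumpVec x (1 - (n : ℤ)) = Pi.single k 1} := by
  have hZ : ∀ n : ℕ, Measurable fun x => jumpVec x (1 - (n : ℤ)) := fun n => measurable_jumpVec _
  induction n generalizing k with
  | zero =>
    rw [Nat.cast_zero, sub_zero]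
    have h1 := hω.lintegral_jumpVec_one hexit k
    have h2 : 0 < 1 / (1 - α ω 0 - β ω 0) * ![p₁ ω 0, γ ω 0, p₂ ω 0] k := by
      refine mul_pos (one_div_pos.2 (hω.one_sub_α_sub_β_pos 0)) ?_
      fin_cases k
      · exact hω.p₁_pos 0
      · exact hω.γ_pos 0
      · exact hω.p₂_pos 0
    rw [← ENNReal.ofReal_pos, ← h1] at h2
    have hm : MeasurableSet {x | jumpVec x 1 = Pi.single k 1} :=
      measurable_jumpVec 1 (measurableSet_singleton _)
    refine h2.trans_le ?_
    rw [← lintegral_indicator_one hm]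
    refine lintegral_mono_ae ?_
    filter_upwards [ae_isWalkPath hexit] with x hx
    obtain ⟨l, hl⟩ := hx.jumpVec_one
    by_cases h : l = k
    · rw [Set.indicator_of_mem (by rw [Set.mem_ofPred_eq, hl, h]), hl, h]
      simp
    · rw [hl, Pi.single_eq_of_ne (fun h' => h h'.symm)]
      simp
  | succ n ih =>
    have hstep : ∀ k', 0 < offspring ω (-(n : ℤ)) k' {Pi.single k 1} →
        0 < quenched ω 0 {x | jumpVec x (1 - ((n + 1 : ℕ) : ℤ)) = Pi.single k 1} := by
      intro k' hk'
      have h1 := (hω.hasBranchingGen hexit).measure_single_inter hZ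
        (fun n => hω.isProbabilityMeasure_offspring _) n k' (Pi.single k 1)
      have h2 := ENNReal.mul_pos (ih k').ne' hk'.ne'
      rw [← h1] at h2
      exact h2.trans_le (measure_mono Set.inter_subset_right)
    have hgeom := geomOffspring_singleton_pos (hω.α_pos (-(n : ℤ))) (hω.β_pos (-(n : ℤ)))
      (hω.α_add_β_lt_one _)
    have hsingle : (Pi.single k 1 : Fin 3 → ℕ) =
        ![(Pi.single k 1 : Fin 3 → ℕ) 0, (Pi.single k 1 : Fin 3 → ℕ) 1,
          (Pi.single k 1 : Fin 3 → ℕ) 2] := by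
      funext t
      fin_cases t <;> rfl
    -- A parent of type `1` has exactly one child of type `2`, other parents have none, and the
    -- remaining counts are unrestricted. This dictates the parent.
    refine hstep (if k = 2 then 1 else 0) ?_
    rw [hsingle, offspring]
    have e : (![0, 1, 0] : Fin 3 → ℕ) (if k = 2 then 1 else 0) = (Pi.single k 1 : Fin 3 → ℕ) 2 := by
      fin_cases k <;> rfl
    rw [e]
    exact hgeom _ _ _

/-- Given the single parent `e_k`, the total offspring is that of one particle; the conditioning
event has positive probability, so one may divide by it. -/
lemma offspringLaw_eq (hω : IsPositiveEnv ω)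
    (hexit : ∀ᵐ x ∂quenched ω 0, ∃ n, 0 < x n) (n : ℕ) (k : Fin 3) :
    offspringLaw ω (-(n : ℤ)) k = offspring ω (-(n : ℤ)) k := by
  have hZ : ∀ n : ℕ, Measurable fun x => jumpVec x (1 - (n : ℤ)) := fun n => measurable_jumpVec _
  have e1 : 1 - ((n + 1 : ℕ) : ℤ) = -(n : ℤ) := by push_cast; ring
  have e2 : -(n : ℤ) + 1 = 1 - (n : ℤ) := by ring
  have hset : {x | U x (-(n : ℤ) + 1) = Pi.single k 1} =ᵐ[quenched ω 0]
      {x | jumpVec x (1 - (n : ℤ)) = Pi.single k 1} := by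
    filter_upwards [ae_isWalkPath hexit] with x hx
    refine propext ?_
    change U x (-(n : ℤ) + 1) = _ ↔ jumpVec x (1 - (n : ℤ)) = _
    rw [e2, hx.U_eq (by omega)]
  have hm : MeasurableSet {x | jumpVec x (1 - (n : ℤ)) = Pi.single k 1} :=
    hZ n (measurableSet_singleton _)
  have hcond : (quenched ω 0)[|{x | U x (-(n : ℤ) + 1) = Pi.single k 1}] =
      (quenched ω 0)[|{x | jumpVec x (1 - (n : ℤ)) = Pi.single k 1}] := by
    rw [ProbabilityTheory.cond, ProbabilityTheory.cond, measure_congr hset, Measure.restrict_congr_set hset]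
  rw [offspringLaw, hcond]
  have hU : (fun x => U x (-(n : ℤ))) =ᵐ[(quenched ω 0)[|{x | jumpVec x (1 - (n : ℤ)) =
      Pi.single k 1}]] fun x => jumpVec x (-(n : ℤ)) := by
    refine cond_absolutelyContinuous.ae_le ?_
    filter_upwards [ae_isWalkPath hexit] with x hx
    exact hx.U_eq (by omega)
  rw [Measure.map_congr hU]
  refine Measure.ext_of_singleton fun u => ?_
  rw [Measure.map_apply (measurable_jumpVec _) (measurableSet_singleton _), cond_apply hm]
  have h1 := (hω.hasBranchingGen hexit).measure_single_inter hZ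
    (fun n => hω.isProbabilityMeasure_offspring _) n k u
  simp only [e1] at h1
  refine (congrArg _ h1).trans ?_
  rw [← mul_assoc, ENNReal.inv_mul_cancel (hω.measure_jumpVec_single_pos hexit n k).ne'
    (measure_ne_top _ _), one_mul]

/-- `U` agrees almost surely with the measurable `jumpVec`, so the branching property carries over.
-/
lemma isMultitypeBranching_U (hω : IsPositiveEnv ω)
    (hexit : ∀ᵐ x ∂quenched ω 0, ∃ n, 0 < x n) :
    IsMultitypeBranching (quenched ω 0) (fun n x => U x (1 - (n : ℤ)))
      (fun n => offspringLaw ω (-(n : ℤ))) := by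
  have hZ : ∀ n : ℕ, Measurable fun x => jumpVec x (1 - (n : ℤ)) := fun n => measurable_jumpVec _
  have hκ : (fun n : ℕ => offspringLaw ω (-(n : ℤ))) = fun n : ℕ => offspring ω (-(n : ℤ)) := by
    funext n k
    exact hω.offspringLaw_eq hexit n k
  have h := (hω.hasBranchingGen hexit).isMultitypeBranching hZ
    fun n => hω.isProbabilityMeasure_offspring _
  have hset : ∀ (n : ℕ) (z : ℕ → Fin 3 → ℕ), quenched ω 0 {x | ∀ m ≤ n, U x (1 - (m : ℤ)) = z m} =
      quenched ω 0 {x | ∀ m ≤ n, jumpVec x (1 - (m : ℤ)) = z m} := by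
    intro n z
    refine measure_congr ?_
    filter_upwards [ae_isWalkPath hexit] with x hx
    refine propext (forall₂_congr fun m _ => ?_)
    rw [hx.U_eq (by omega)]
  rw [hκ]
  refine ⟨fun n => ⟨_, hZ n, ?_⟩, h.2, fun n z => ?_⟩
  · filter_upwards [ae_isWalkPath hexit] with x hx
    exact hx.U_eq (by omega)
  · rw [hset, hset]
    exact h.3 n z

/-! ### Means of the offspring, of the generations and of the ladder time -/

lemma integrable_offspring (hω : IsPositiveEnv ω) (j : ℤ) (k l : Fin 3) :
    Integrable (fun u : Fin 3 → ℕ => (u l : ℝ)) (offspring ω j k) := by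
  have hm : Measurable fun u : Fin 3 → ℕ => (u l : ℝ) := measurable_of_countable _
  rw [← lintegral_ofReal_ne_top_iff_integrable hm.aestronglyMeasurable
    (ae_of_all _ fun u => Nat.cast_nonneg _)]
  simp only [ENNReal.ofReal_natCast]
  rw [hω.lintegral_offspring]
  exact ENNReal.ofReal_ne_top

lemma meanMatrix_offspring (hω : IsPositiveEnv ω) (j : ℤ) :
    meanMatrix (offspring ω j) = N ω j := by
  ext k l
  have hm : Measurable fun u : Fin 3 → ℕ => (u l : ℝ) := measurable_of_countable _
  rw [meanMatrix, Matrix.of_apply,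
    integral_eq_lintegral_of_nonneg_ae (ae_of_all _ fun u => Nat.cast_nonneg _)
      hm.aestronglyMeasurable]
  simp only [ENNReal.ofReal_natCast]
  rw [hω.lintegral_offspring, ENNReal.toReal_ofReal (hω.N_nonneg j k l)]

lemma Nprod_nonneg (hω : IsPositiveEnv ω) (n : ℕ) (k l : Fin 3) : 0 ≤ Nprod ω n k l := by
  induction n generalizing l with
  | zero => exact hω.N_nonneg 0 k l
  | succ n ih =>
    rw [Nprod, Matrix.mul_apply]
    exact Finset.sum_nonneg fun i _ => mul_nonneg (ih i) (hω.N_nonneg _ i l)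

/-- The mean of `U(-n)`. -/
lemma lintegral_jumpVec_neg (hω : IsPositiveEnv ω)
    (hexit : ∀ᵐ x ∂quenched ω 0, ∃ n, 0 < x n) (n : ℕ) (l : Fin 3) :
    ∫⁻ x, (jumpVec x (-(n : ℤ)) l : ℝ≥0∞) ∂quenched ω 0 =
      ∑ k, ENNReal.ofReal (1 / (1 - α ω 0 - β ω 0) * ![p₁ ω 0, γ ω 0, p₂ ω 0] k) *
        ENNReal.ofReal (Nprod ω n k l) := by
  have hrec := fun n l => (hω.hasBranchingGen hexit).lintegral_succ
    (fun n => measurable_jumpVec _) (fun n => hω.isProbabilityMeasure_offspring _) n l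
  have e1 : ∀ n : ℕ, 1 - ((n + 1 : ℕ) : ℤ) = -(n : ℤ) := fun n => by push_cast; ring
  simp only [hω.lintegral_offspring, e1] at hrec
  induction n generalizing l with
  | zero =>
    rw [hrec]
    simp only [Nat.cast_zero, sub_zero, neg_zero, hω.lintegral_jumpVec_one hexit, Nprod]
  | succ n ih =>
    rw [hrec]
    have e2 : -((n + 1 : ℕ) : ℤ) = -((n : ℤ) + 1) := by push_cast; ring
    simp only [e1, ih, Finset.sum_mul, Nprod, Matrix.mul_apply, e2]
    rw [Finset.sum_comm]
    refine Finset.sum_congr rfl fun k _ => ?_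
    rw [ENNReal.ofReal_sum_of_nonneg
      fun i _ => mul_nonneg (hω.Nprod_nonneg n k i) (hω.N_nonneg _ i l), Finset.mul_sum]
    refine Finset.sum_congr rfl fun i _ => ?_
    rw [ENNReal.ofReal_mul (hω.Nprod_nonneg n k i), mul_assoc]

/-- The pathwise identity for `T₁` is integrated term by term; all terms are nonnegative, so the
value may be infinite. -/
lemma lintegral_T₁ (hω : IsPositiveEnv ω) (hexit : ∀ᵐ x ∂quenched ω 0, ∃ n, 0 < x n) :
    ∫⁻ x, (T₁ x : ℝ≥0∞) ∂quenched ω 0 =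
      1 + ![2, 2, 1] ⬝ᵥ
        ((fun j => ENNReal.ofReal
            (1 / (1 - α ω 0 - β ω 0) * ![p₁ ω 0, γ ω 0, p₂ ω 0] j)) ᵥ*
          ∑' n : ℕ, (Nprod ω n).map ENNReal.ofReal) := by
  have hm : ∀ (i : ℤ) (t : Fin 3), Measurable fun x => (jumpVec x i t : ℝ≥0∞) := fun i t =>
    (measurable_of_countable fun u : Fin 3 → ℕ => (u t : ℝ≥0∞)).comp (measurable_jumpVec i)
  have h1 : ∫⁻ x, (T₁ x : ℝ≥0∞) ∂quenched ω 0 = ∫⁻ x, (1 + ∑' n : ℕ, ∑ t,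
      (![2, 2, 1] : Fin 3 → ℝ≥0∞) t * (jumpVec x (-(n : ℤ)) t : ℝ≥0∞)) ∂quenched ω 0 := by
    refine lintegral_congr_ae ?_
    filter_upwards [ae_isWalkPath hexit] with x hx using hx.T₁_eq_tsum
  -- The matrix series converges entrywise, since every series in `[0, ∞]` is summable.
  have hM : ∀ k l, (∑' n : ℕ, (Nprod ω n).map ENNReal.ofReal) k l =
      ∑' n : ℕ, ENNReal.ofReal (Nprod ω n k l) := by
    intro k l
    have hs : Summable fun n : ℕ => (Nprod ω n).map ENNReal.ofReal :=
      Pi.summable.2 fun k => Pi.summable.2 fun l => ENNReal.summable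
    have h2 : (∑' n : ℕ, (Nprod ω n).map ENNReal.ofReal) k =
        ∑' n : ℕ, (Nprod ω n).map ENNReal.ofReal k := tsum_apply hs
    rw [h2, tsum_apply (Pi.summable.2 fun l => ENNReal.summable)]
    rfl
  rw [h1, lintegral_add_left measurable_const, lintegral_const, measure_univ, mul_one,
    lintegral_tsum fun n => (Finset.measurable_fun_sum _ fun t _ =>
      (hm _ t).const_mul _).aemeasurable]
  congr 1
  have h3 : ∀ n : ℕ, ∫⁻ x, ∑ t, (![2, 2, 1] : Fin 3 → ℝ≥0∞) t *
      (jumpVec x (-(n : ℤ)) t : ℝ≥0∞) ∂quenched ω 0 = ∑ t, (![2, 2, 1] : Fin 3 → ℝ≥0∞) t *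
        ∑ k, ENNReal.ofReal (1 / (1 - α ω 0 - β ω 0) * ![p₁ ω 0, γ ω 0, p₂ ω 0] k) *
          ENNReal.ofReal (Nprod ω n k t) := by
    intro n
    rw [lintegral_finsetSum _ fun t _ => (hm _ t).const_mul _]
    refine Finset.sum_congr rfl fun t _ => ?_
    rw [lintegral_const_mul _ (hm _ t), hω.lintegral_jumpVec_neg hexit]
  simp only [h3, dotProduct, Matrix.vecMul, hM]
  rw [Summable.tsum_finsetSum fun _ _ => ENNReal.summable]
  refine Finset.sum_congr rfl fun t _ => ?_
  rw [ENNReal.tsum_mul_left, Summable.tsum_finsetSum fun _ _ => ENNReal.summable]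
  simp only [ENNReal.tsum_mul_left]

end IsPositiveEnv

end RWRE

theorem corollary1p1 (P : Measure Env) [IsProbabilityMeasure P]
    (hP : Ergodic shift P)
    (hell : ∃ ε : ℝ, 0 < ε ∧ ∀ᵐ ω ∂P, ∀ x : ℤ,
      0 < q ω x ∧ ε ≤ p₁ ω x / q ω x ∧ ε ≤ p₂ ω x / q ω x)
    (htrans : ∀ᵐ z ∂annealed P, Tendsto z.2 atTop atTop) :
    ∀ᵐ ω ∂P,
      IsMultitypeBranching (quenched ω 0) (fun n x => U x (1 - (n : ℤ)))
          (fun n => offspringLaw ω (-(n : ℤ))) ∧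
      (∀ i : ℤ, i ≤ 0 →
        0 < 1 - α ω i - β ω i ∧
        (∀ k l : Fin 3, Integrable (fun u => (u l : ℝ)) (offspringLaw ω i k)) ∧
        meanMatrix (offspringLaw ω i) = N ω i) ∧
      ∫⁻ x, (T₁ x : ℝ≥0∞) ∂quenched ω 0 =
        1 + ![2, 2, 1] ⬝ᵥ
          ((fun j => ENNReal.ofReal
              (1 / (1 - α ω 0 - β ω 0) * ![p₁ ω 0, γ ω 0, p₂ ω 0] j)) ᵥ*
            ∑' n : ℕ, (Nprod ω n).map ENNReal.ofReal) := by
  obtain ⟨ε, hε, hell⟩ := hell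
  filter_upwards [hell, Measure.ae_ae_of_ae_compProd htrans] with ω hω1 hω2
  have hω : IsPositiveEnv ω := by
    have hpos : ∀ {x p : ℝ}, 0 < x → ε ≤ p / x → 0 < p := fun hx h =>
      (div_pos_iff_of_pos_right hx).1 (hε.trans_le h)
    exact ⟨fun x => (hω1 x).1, fun x => hpos (hω1 x).1 (hω1 x).2.1,
      fun x => hpos (hω1 x).1 (hω1 x).2.2⟩
  -- Transience to the right enters the quenched argument as almost sure arrival in `(0, ∞)`.
  have hexit : ∀ᵐ x ∂quenched ω 0, ∃ n, 0 < x n := by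
    filter_upwards [hω2] with x hx using (hx.eventually_gt_atTop 0).exists
  refine ⟨hω.isMultitypeBranching_U hexit, fun i hi => ?_, hω.lintegral_T₁ hexit⟩
  obtain ⟨n, rfl⟩ : ∃ n : ℕ, i = -(n : ℤ) := ⟨(-i).toNat, by omega⟩
  have hκ : offspringLaw ω (-(n : ℤ)) = offspring ω (-(n : ℤ)) :=
    funext fun k => hω.offspringLaw_eq hexit n k
  rw [hκ]
  exact ⟨hω.one_sub_α_sub_β_pos _, hω.integrable_offspring _, hω.meanMatrix_offspring _⟩
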